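/- Let $n\ge 2$, let $D\subset\mathbb R^n$ be a bounded domain and let $s\colon D\to[1,\infty)$ be measurable and log-Hölder continuous, i.e. for some $c>0$, $|s(x)-s(y)|\le c/\log(e+1/|x-y|)$ for all $x\ne y$ in $D$. Write $s^-:=\operatorname{ess\,inf}_D s$, $s^+:=\operatorname{ess\,sup}_D s$ and assume $1\le s^-\le s^+<\frac n{n-1}$. Suppose that $D$ is an $s(\cdot)$-John domain with John centre $x_0\in D$: there are constants $0<\alpha_0\le\beta_0<\infty$ such that each $x\in D$ can be joined to $x_0$ by a rectifiable curve $\gamma_x\colon[0,\ell]\to D$, parametrized by arc length, with $\gamma_x(0)=x$, $\gamma_x(\ell)=x_0$, $\ell\le\beta_0$ and $t^{s(x)}\le\frac{\beta_0}{\alpha_0}\operatorname{dist}(\gamma_x(t),\partial D)$ for all $t\in[0,\ell]$. Put $\alpha(x):=n-s(x)(n-1)$ and $B:=B(x_0,\operatorname{dist}(x_0,\partial D))$. For $p\colon D\to[1,\infty)$ measurable and bounded, $L^{p(\cdot)}(D)$ is the set of measurable $f$ on $D$ with $\int_D|f|^{p(x)}dx<\infty$, with the norm $\|f\|_{L^{p(\cdot)}(D)}=\inf\{\lambda>0:\int_D|f(x)/\lambda|^{p(x)}dx\le1\}$,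 and $L^1_{p(\cdot)}(D)$ is the set of $u\in W^{1,1}_{\mathrm{loc}}(D)$ with $|\nabla u|\in L^{p(\cdot)}(D)$. For $A\subset D$ let $$\mathcal H^{s(\cdot)(n-1)}_\infty(A):=\inf\Big\{\sum_{i=1}^\infty r_i^{s(x_i)(n-1)}:\ A\subset\bigcup_{i=1}^\infty B(x_i,r_i),\ x_i\in D,\ r_i\ge0\Big\},$$ and for $f\colon D\to\mathbb R$ let $\int_D|f|\,d\mathcal H^{s(\cdot)(n-1)}_\infty:=\int_0^\infty\mathcal H^{s(\cdot)(n-1)}_\infty(\{x\in D:|f(x)|>t\})\,dt$ (Choquet integral). Then there exist constants $a,b>0$ such that $$\int_D\exp\Big(a\,|u-u_B|^{\frac{n}{s^+(n-1)}}\Big)\,d\mathcal H^{s(\cdot)(n-1)}_\infty\le b$$ for all $u\in L^1_{n/\alpha(\cdot)}(D)$ with $\|\nabla u\|_{L^{n/\alpha(\cdot)}(D)}\le1$. Here $u_B$ is the average of $u$ over $B$, and the pointwise values of $u$ in the integrand are those of its precise representative, $u(x)=\lim_{r\to0^+}\frac1{|B(x,r)|}\int_{B(x,r)}u\,dy$ where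 this limit exists, and $u(x)=0$ elsewhere. -/

import Mathlib

open MeasureTheory Set Filter Topology
open scoped ENNReal ContDiff

noncomputable section

/-- `g` is log-Hölder continuous on `U`. -/
def IsLogHolderOn {E : Type*} [MetricSpace E] (g : E → ℝ) (U : Set E) : Prop :=
  ∃ c : ℝ, 0 < c ∧ ∀ x ∈ U, ∀ y ∈ U, x ≠ y →
    |g x - g y| ≤ c / Real.log (Real.exp 1 + 1 / dist x y)

/-- The essential supremum of `g` on `U`. -/
def essSupOn {E : Type*} [MeasureSpace E] (g : E → ℝ) (U : Set E) : ℝ :=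
  essSup g (volume.restrict U)

/-- The essential infimum of `g` on `U`. -/
def essInfOn {E : Type*} [MeasureSpace E] (g : E → ℝ) (U : Set E) : ℝ :=
  essInf g (volume.restrict U)

/-- `p` is a log-Hölder continuous variable exponent on `U`: a measurable, essentially bounded,
log-Hölder continuous function with values in `[1, ∞)`. Values of `p` outside `U` are irrelevant. -/
structure IsLogHolderExponent {E : Type*} [MetricSpace E] [MeasureSpace E]
    (p : E → ℝ) (U : Set E) : Prop where
  measurable : Measurable (fun x : U => p x)
  one_le : ∀ x ∈ U, 1 ≤ p x
  essBounded : ∃ C : ℝ, ∀ᵐ x ∂(volume.restrict U), p x ≤ C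
  logHolder : IsLogHolderOn p U

/-- The modular `∫_U |f(x)| ^ p(x) dx`. -/
def varModular {E : Type*} [MeasureSpace E] (U : Set E) (p : E → ℝ) (f : E → ℝ) : ℝ≥0∞ :=
  ∫⁻ x in U, ENNReal.ofReal (|f x| ^ p x)

/-- Membership in the variable exponent Lebesgue space `L^{p(·)}(U)`. -/
def MemVarLp {E : Type*} [MeasureSpace E] (U : Set E) (p : E → ℝ) (f : E → ℝ) : Prop :=
  AEStronglyMeasurable f (volume.restrict U) ∧ varModular U p f < ⊤

/-- The Luxemburg--Nakano norm on `L^{p(·)}(U)`, with value `∞` if no `l` is admissible. -/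
def luxemburgNorm {E : Type*} [MeasureSpace E] (U : Set E) (p : E → ℝ) (f : E → ℝ) : ℝ≥0∞ :=
  ⨅ (l : ℝ) (_ : 0 < l) (_ : varModular U p (fun x => f x / l) ≤ 1), ENNReal.ofReal l

/-- `u` lies in `W^{1,1}_loc(U)` and its distributional gradient is represented by `g`. -/
structure HasWeakGradientOn {n : ℕ} (U : Set (EuclideanSpace ℝ (Fin n)))
    (u : EuclideanSpace ℝ (Fin n) → ℝ)
    (g : EuclideanSpace ℝ (Fin n) → EuclideanSpace ℝ (Fin n)) : Prop where
  locallyIntegrable : LocallyIntegrableOn u U volume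
  locallyIntegrable_grad : LocallyIntegrableOn g U volume
  integral_eq : ∀ φ : EuclideanSpace ℝ (Fin n) → ℝ, ContDiff ℝ ∞ φ → HasCompactSupport φ →
    tsupport φ ⊆ U → ∀ v : EuclideanSpace ℝ (Fin n),
      ∫ x in U, u x * fderiv ℝ φ x v = - ∫ x in U, inner ℝ (g x) v * φ x

/-- `u` belongs to the variable exponent Sobolev space `L^1_{p(·)}(U)`, with distributional
gradient `g`. The gradient is determined by `u` up to a null set of `U`. -/
structure MemVarSobolev {n : ℕ} (U : Set (EuclideanSpace ℝ (Fin n)))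
    (p : EuclideanSpace ℝ (Fin n) → ℝ) (u : EuclideanSpace ℝ (Fin n) → ℝ)
    (g : EuclideanSpace ℝ (Fin n) → EuclideanSpace ℝ (Fin n)) : Prop where
  hasWeakGradient : HasWeakGradientOn U u g
  memVarLp : MemVarLp U p (fun x => ‖g x‖)

open Classical in
/-- The precise representative of a locally integrable function: the limit of the averages over
balls shrinking to `x` where it exists, and `0` elsewhere. -/
def preciseRep {E : Type*} [MetricSpace E] [MeasureSpace E] (u : E → ℝ) (x : E) : ℝ :=
  if h : ∃ l : ℝ, Tendsto (fun r : ℝ => ⨍ y in Metric.ball x r, u y) (𝓝[>] 0) (𝓝 l)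
  then h.choose else 0

/-- The variable dimensional Hausdorff content `H_∞^{β(·)}(A)` for a dimension function `β` that is
defined on `U` (its values outside `U` are not used): the infimum of `∑ r_i ^ β(x_i)` over all
countable covers of `A` by open balls `B(x_i, r_i)` with centres in the domain `U` of `β`.
Empty balls, `r_i = 0`, are allowed, so that finite covers are included. -/
def varHausdorffContent {E : Type*} [MetricSpace E] (U : Set E) (β : E → ℝ) (A : Set E) : ℝ≥0∞ :=
  ⨅ (x : ℕ → E) (r : ℕ → ℝ) (_ : ∀ i, x i ∈ U) (_ : ∀ i, 0 ≤ r i)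
    (_ : A ⊆ ⋃ i, Metric.ball (x i) (r i)), ∑' i, ENNReal.ofReal (r i ^ β (x i))

/-- The Choquet integral `∫_U |f| dH = ∫_0^∞ H({x ∈ U : |f(x)| > t}) dt` of `f` over `U` with
respect to a set function `H`. -/
def choquetIntegral {E : Type*} (H : Set E → ℝ≥0∞) (U : Set E) (f : E → ℝ) : ℝ≥0∞ :=
  ∫⁻ t in Ioi (0 : ℝ), H {x ∈ U | t < |f x|}

/-- `D` is an `s(·)`-John domain with John centre `x₀` and John constants `a ≤ b`. -/
structure IsVarJohnDomainWith {n : ℕ} (D : Set (EuclideanSpace ℝ (Fin n)))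
    (s : EuclideanSpace ℝ (Fin n) → ℝ) (x₀ : EuclideanSpace ℝ (Fin n)) (a b : ℝ) : Prop where
  isOpen : IsOpen D
  isConnected : IsConnected D
  isBounded : Bornology.IsBounded D
  one_le : ∀ x ∈ D, 1 ≤ s x
  center_mem : x₀ ∈ D
  const_pos : 0 < a
  const_le : a ≤ b
  exists_curve : ∀ x ∈ D, ∃ (L : ℝ) (γ : ℝ → EuclideanSpace ℝ (Fin n)),
    0 ≤ L ∧ L ≤ b ∧ HasUnitSpeedOn γ (Icc 0 L) ∧ MapsTo γ (Icc 0 L) D ∧ γ 0 = x ∧ γ L = x₀ ∧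
      ∀ t ∈ Icc 0 L, t ^ s x ≤ b / a * Metric.infDist (γ t) (frontier D)

/-- `D` is an `s(·)`-John domain with John centre `x₀`. -/
def IsVarJohnDomain {n : ℕ} (D : Set (EuclideanSpace ℝ (Fin n)))
    (s : EuclideanSpace ℝ (Fin n) → ℝ) (x₀ : EuclideanSpace ℝ (Fin n)) : Prop :=
  ∃ a b : ℝ, IsVarJohnDomainWith D s x₀ a b

end

/-! Write `n = m + 1`. The proof compares `u` pointwise with a potential of its gradient, and then
bounds this potential off a set of small content.

Pointwise bound. Along the John curve from `x`, the tube at time about `t` may have radius about `t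
^ s x`. Averages of `u` over two balls of radius `ρ` in such a tube differ by at most a multiple of
`ρ ^ (1 - n)` times the integral of `|∇u|` over the tube: this is the Poincaré inequality on balls,
summed along a chain. A chain with no shortcuts has bounded overlap, so the length of the curve does
not enter. Summing over dyadic times bounds `|u x - u_B|` by `dyadicPotential` of order `s x * m`
(`exists_edist_preciseRep_le`). Where the potential is finite, the averages over balls at `x`
converge, so the bound concerns the precise representative at that very point.

Potential bound. Let `w = |∇u| ^ p` with `p = n / α`; its integral is bounded. The conjugate
exponent of `p y` is `n / (s y * m)`, which is at least `q = n / (s⁺ * m) > 1`. By log-Hölder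
continuity, `r ^ (-(s x * m))` raised to that power is at most a constant times `r ^ (-n)` when
`dist x y < r`. Young's inequality with parameter `t ≥ 1` then bounds the contribution of a dyadic
annulus `A` by `t * ∫_A w + C * t ^ (1 - q)`. On the first `M` annuli take `t = M ^ (1 / q)`. If the
ball at scale `M + k` carries `w`-mass at most `2⁻ᵏ` for every `k`, geometric choices of `t` make
the remaining sum bounded. The potential is then at most `C * M ^ (1 / q)`
(`exists_dyadicPotential_le`).

Exceptional set. The points where some ball at scale `M + k` has mass above `2⁻ᵏ` are covered by
Vitali's lemma. As `s * m ≥ 1`, a ball of radius about `2^(-(M + k))` costs at most a constant times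
`2⁻ᴹ * 2⁻ᵏ`, and its mass pays for `2⁻ᵏ`; the content is at most `C * 2⁻ᴹ`
(`varHausdorffContent_concentration_le`). Hence `|u - u_B| > C * M ^ (1 / q)` only on a set of
content at most `C * 2⁻ᴹ`, which is exponential integrability of `|u - u_B| ^ q`
(`exists_choquetIntegral_exp_le`). -/

/-! ### Poincaré inequality on balls for `C¹` functions -/

theorem enorm_sub_le_lintegral_fderiv {E : Type*} [NormedAddCommGroup E] [NormedSpace ℝ E]
    {w : E → ℝ} (hw : ContDiff ℝ 1 w) (y z : E) :
    ‖w y - w z‖ₑ ≤ ‖y - z‖ₑ * ∫⁻ t in Icc (0 : ℝ) 1, ‖fderiv ℝ w ((1 - t) • z + t • y)‖ₑ := by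
  have hline : ∀ t : ℝ, HasDerivAt (fun t : ℝ => (1 - t) • z + t • y) (y - z) t := by
    intro t
    have h1 : HasDerivAt (fun t : ℝ => (1 - t) • z) ((-1 : ℝ) • z) t :=
      ((hasDerivAt_id t).const_sub 1).smul_const z
    have h2 : HasDerivAt (fun t : ℝ => t • y) ((1 : ℝ) • y) t := (hasDerivAt_id t).smul_const y
    have := h1.add h2
    convert this using 1
    · rfl
    · rw [neg_one_smul, one_smul, sub_eq_neg_add]
  have hd : ∀ t : ℝ, deriv (fun t : ℝ => w ((1 - t) • z + t • y)) t
      = fderiv ℝ w ((1 - t) • z + t • y) (y - z) := fun t =>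
    ((hw.differentiable (by norm_num) _).hasFDerivAt.comp_hasDerivAt t (hline t)).deriv
  have hC : ContDiff ℝ 1 (fun t : ℝ => w ((1 - t) • z + t • y)) := by
    apply hw.comp
    fun_prop
  have := enorm_sub_le_lintegral_deriv_of_contDiffOn_Icc (a := 0) (b := 1) hC.contDiffOn zero_le_one
  simp only [sub_self, zero_smul, one_smul, zero_add, sub_zero, add_zero] at this
  refine this.trans ?_
  rw [← lintegral_const_mul' _ _ enorm_ne_top]
  refine lintegral_mono fun t => ?_
  rw [hd, mul_comm]
  exact ContinuousLinearMap.le_opENorm _ _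

section SmoothPoincare

variable {E : Type*} [NormedAddCommGroup E] [NormedSpace ℝ E] [MeasurableSpace E] [BorelSpace E]
  [FiniteDimensional ℝ E] (μ : Measure E) [μ.IsAddHaarMeasure]

theorem lintegral_comp_add_smul {F : E → ℝ≥0∞} (hF : Measurable F) (a : E) {t : ℝ} (ht : t ≠ 0) :
    ∫⁻ y, F (a + t • y) ∂μ = ENNReal.ofReal |(t ^ Module.finrank ℝ E)⁻¹| * ∫⁻ y, F y ∂μ := by
  have h1 : ∫⁻ y, F (a + t • y) ∂μ = ∫⁻ z, F (a + z) ∂(Measure.map (fun y => t • y) μ) := by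
    rw [lintegral_map (by fun_prop) (by fun_prop)]
  rw [h1, Measure.map_addHaar_smul μ ht, lintegral_smul_measure, lintegral_add_left_eq_self F a,
    smul_eq_mul]

/-- Averaging over segments that end at a fixed point of a convex set, away from that point. -/
theorem setLIntegral_comp_segment_le {F : E → ℝ≥0∞} (hF : Measurable F) {B : Set E}
    (hB : MeasurableSet B) (hconv : Convex ℝ B) {a : E} (ha : a ∈ B) {t : ℝ}
    (ht : 1 / 2 ≤ t) (ht1 : t ≤ 1) :
    ∫⁻ y in B, F ((1 - t) • a + t • y) ∂μ
      ≤ 2 ^ Module.finrank ℝ E * ∫⁻ y in B, F y ∂μ := by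
  have ht0 : 0 < t := by linarith
  rw [← lintegral_indicator hB, ← lintegral_indicator hB]
  calc ∫⁻ y, B.indicator (fun y => F ((1 - t) • a + t • y)) y ∂μ
      ≤ ∫⁻ y, B.indicator F ((1 - t) • a + t • y) ∂μ := by
        refine lintegral_mono fun y => ?_
        by_cases hy : y ∈ B
        · have : (1 - t) • a + t • y ∈ B := hconv ha hy (by linarith) ht0.le (by ring)
          simp [hy, this]
        · simp [hy]
    _ = ENNReal.ofReal |(t ^ Module.finrank ℝ E)⁻¹| * ∫⁻ y, B.indicator F y ∂μ :=
        lintegral_comp_add_smul μ (hF.indicator hB) _ ht0.ne'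
    _ ≤ 2 ^ Module.finrank ℝ E * ∫⁻ y, B.indicator F y ∂μ := by
        gcongr
        rw [abs_of_pos (by positivity), ← inv_pow]
        have : t⁻¹ ≤ 2 := by
          rw [inv_le_comm₀ ht0 (by norm_num)]; linarith
        calc ENNReal.ofReal (t⁻¹ ^ Module.finrank ℝ E)
            ≤ ENNReal.ofReal (2 ^ Module.finrank ℝ E) := by gcongr
          _ = 2 ^ Module.finrank ℝ E := by
            rw [ENNReal.ofReal_pow (by norm_num)]; simp

/-- The `L¹` Poincaré inequality for `C¹` functions on a ball. -/
theorem lintegral_ball_sub_le_of_contDiff {w : E → ℝ} (hw : ContDiff ℝ 1 w) (x : E) (r : ℝ) :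
    ∫⁻ p in Metric.ball x r ×ˢ Metric.ball x r, ‖w p.1 - w p.2‖ₑ ∂(μ.prod μ)
      ≤ 2 ^ (Module.finrank ℝ E + 1) * ENNReal.ofReal r * μ (Metric.ball x r) *
        ∫⁻ y in Metric.ball x r, ‖fderiv ℝ w y‖ₑ ∂μ := by
  set B := Metric.ball x r with hBdef
  set d := Module.finrank ℝ E
  have hB : MeasurableSet B := measurableSet_ball
  have hconv : Convex ℝ B := convex_ball x r
  have hcont : Continuous (fderiv ℝ w) := hw.continuous_fderiv (by norm_num)
  have hH : Measurable (fun y => ‖fderiv ℝ w y‖ₑ) := hcont.enorm.measurable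
  set H : E → ℝ≥0∞ := fun y => ‖fderiv ℝ w y‖ₑ with hHdef
  set I := ∫⁻ y in B, H y ∂μ with hI
  have hjoint : Continuous (fun q : (E × E) × ℝ => H ((1 - q.2) • q.1.2 + q.2 • q.1.1)) := by
    simp only [hHdef]
    fun_prop
  have hslice : ∀ t ∈ Icc (0 : ℝ) 1,
      ∫⁻ p in B ×ˢ B, H ((1 - t) • p.2 + t • p.1) ∂(μ.prod μ) ≤ 2 ^ d * μ B * I := by
    intro t ht
    have hm : Measurable (fun p : E × E => H ((1 - t) • p.2 + t • p.1)) :=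
      (hjoint.comp (by fun_prop : Continuous fun p : E × E => (p, t))).measurable
    rw [← Measure.prod_restrict]
    -- Integrate first in the endpoint whose weight is at least `1 / 2`: the contraction towards the
    -- other endpoint then costs at most the factor `2 ^ d`.
    rcases le_total (1 / 2) t with h | h
    · rw [lintegral_prod_symm _ hm.aemeasurable]
      calc ∫⁻ z in B, ∫⁻ y in B, H ((1 - t) • z + t • y) ∂μ ∂μ
          ≤ ∫⁻ _ in B, 2 ^ d * I ∂μ := by
            refine setLIntegral_mono measurable_const fun z hz => ?_
            exact setLIntegral_comp_segment_le μ hH hB hconv hz h ht.2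
        _ = 2 ^ d * μ B * I := by
            rw [lintegral_const, Measure.restrict_apply_univ]; ring
    · rw [lintegral_prod _ hm.aemeasurable]
      calc ∫⁻ y in B, ∫⁻ z in B, H ((1 - t) • z + t • y) ∂μ ∂μ
          ≤ ∫⁻ _ in B, 2 ^ d * I ∂μ := by
            refine setLIntegral_mono measurable_const fun y hy => ?_
            have := setLIntegral_comp_segment_le μ hH hB hconv hy (t := 1 - t) (by linarith)
              (by linarith [ht.1])
            refine le_trans (le_of_eq ?_) this
            refine lintegral_congr fun z => ?_
            rw [sub_sub_cancel, add_comm]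
        _ = 2 ^ d * μ B * I := by
            rw [lintegral_const, Measure.restrict_apply_univ]; ring
  calc ∫⁻ p in B ×ˢ B, ‖w p.1 - w p.2‖ₑ ∂(μ.prod μ)
      ≤ ∫⁻ p in B ×ˢ B, ENNReal.ofReal (2 * r) *
          (∫⁻ t in Icc (0 : ℝ) 1, H ((1 - t) • p.2 + t • p.1)) ∂(μ.prod μ) := by
        refine setLIntegral_mono' (hB.prod hB) fun p hp => ?_
        refine (enorm_sub_le_lintegral_fderiv hw p.1 p.2).trans ?_
        gcongr
        rw [← edist_eq_enorm_sub, edist_dist]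
        refine ENNReal.ofReal_le_ofReal ?_
        have h1 := Metric.mem_ball.1 hp.1
        have h2 := Metric.mem_ball'.1 hp.2
        linarith [dist_triangle p.1 x p.2]
    _ = ENNReal.ofReal (2 * r) * ∫⁻ p in B ×ˢ B,
          (∫⁻ t in Icc (0 : ℝ) 1, H ((1 - t) • p.2 + t • p.1)) ∂(μ.prod μ) :=
        lintegral_const_mul' _ _ ENNReal.ofReal_ne_top
    _ = ENNReal.ofReal (2 * r) * ∫⁻ t in Icc (0 : ℝ) 1,
          ∫⁻ p in B ×ˢ B, H ((1 - t) • p.2 + t • p.1) ∂(μ.prod μ) := by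
        rw [lintegral_lintegral_swap]
        exact hjoint.measurable.aemeasurable
    _ ≤ ENNReal.ofReal (2 * r) * ∫⁻ t in Icc (0 : ℝ) 1, 2 ^ d * μ B * I := by
        gcongr 1
        exact setLIntegral_mono measurable_const hslice
    _ = 2 ^ (d + 1) * ENNReal.ofReal r * μ B * I := by
        rw [lintegral_const, Measure.restrict_apply_univ, Real.volume_Icc,
          ENNReal.ofReal_mul (by norm_num)]
        simp only [sub_zero, ENNReal.ofReal_one, mul_one, ENNReal.ofReal_ofNat]
        ring

end SmoothPoincare

/-! ### Poincaré inequality for weak gradients, by mollification -/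

section WeakPoincare

variable {n : ℕ} {D : Set (EuclideanSpace ℝ (Fin n))} {u : EuclideanSpace ℝ (Fin n) → ℝ}
  {g : EuclideanSpace ℝ (Fin n) → EuclideanSpace ℝ (Fin n)}

open scoped Convolution in
/-- The gradient of a mollification is controlled by the mollification of the weak gradient. -/
theorem HasWeakGradientOn.enorm_fderiv_convolution_le (h : HasWeakGradientOn D u g)
    {K : Set (EuclideanSpace ℝ (Fin n))} (hD : MeasurableSet D) (hK : IsCompact K) (hKD : K ⊆ D)
    (φ : ContDiffBump (0 : EuclideanSpace ℝ (Fin n))) {a : EuclideanSpace ℝ (Fin n)}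
    (ha : Metric.closedBall a φ.rOut ⊆ K) :
    ‖fderiv ℝ (φ.normed volume ⋆[ContinuousLinearMap.lsmul ℝ ℝ, volume] (K.indicator u)) a‖ₑ
      ≤ ∫⁻ b in D, ‖g b‖ₑ * ‖φ.normed volume (a - b)‖ₑ := by
  set f := φ.normed (volume : Measure (EuclideanSpace ℝ (Fin n))) with hf
  set v := K.indicator u with hv
  have hfc : HasCompactSupport f := φ.hasCompactSupport_normed
  have hfs : ContDiff ℝ ∞ f := φ.contDiff_normed
  have hf1 : ContDiff ℝ 1 f := hfs.of_le (by exact_mod_cast le_top)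
  have hvi : Integrable v volume :=
    ((h.locallyIntegrable.mono_set hKD).integrableOn_isCompact hK).integrable_indicator
      hK.measurableSet
  have hvl : LocallyIntegrable v volume := hvi.locallyIntegrable
  rw [(hfc.hasFDerivAt_convolution_left (ContinuousLinearMap.lsmul ℝ ℝ) hf1 hvl a).fderiv]
  set C := ∫⁻ b in D, ‖g b‖ₑ * ‖f (a - b)‖ₑ with hC
  suffices hsuff : ∀ e : EuclideanSpace ℝ (Fin n),
      ‖(fderiv ℝ f ⋆[ContinuousLinearMap.precompL (EuclideanSpace ℝ (Fin n))
        (ContinuousLinearMap.lsmul ℝ ℝ), volume] v) a e‖ₑ ≤ C * ‖e‖ₑ by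
    by_cases hCt : C = ⊤
    · rw [hCt]; exact le_top
    · rw [← ENNReal.ofReal_toReal hCt, ← ofReal_norm]
      refine ENNReal.ofReal_le_ofReal ?_
      refine ContinuousLinearMap.opNorm_le_bound _ ENNReal.toReal_nonneg fun e => ?_
      have := hsuff e
      rw [← ofReal_norm, ← ofReal_norm e, ← ENNReal.ofReal_toReal hCt,
        ← ENNReal.ofReal_mul ENNReal.toReal_nonneg] at this
      exact (ENNReal.ofReal_le_ofReal_iff (by positivity)).1 this
  intro e
  -- The reflected kernel is an admissible test function: its support lies in `K`, where `v = u`.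
  -- The weak gradient identity then moves the derivative from the kernel onto `u`, and the cut-off
  -- is not seen.
  set ψ : EuclideanSpace ℝ (Fin n) → ℝ := fun b => f (a - b) with hψ
  have hψs : ContDiff ℝ ∞ ψ := hfs.comp (by fun_prop)
  have hts : tsupport f = Metric.closedBall 0 φ.rOut := φ.tsupport_normed_eq
  have hψt : tsupport ψ ⊆ Metric.closedBall a φ.rOut := by
    refine closure_minimal (fun b hb => ?_) Metric.isClosed_closedBall
    have : a - b ∈ tsupport f := subset_closure hb
    rw [hts, mem_closedBall_zero_iff] at this
    rwa [Metric.mem_closedBall', dist_eq_norm]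
  have hψc : HasCompactSupport ψ :=
    (isCompact_closedBall a φ.rOut).of_isClosed_subset (isClosed_tsupport _) hψt
  have hψd : ∀ b, fderiv ℝ ψ b e = - fderiv ℝ f (a - b) e := by
    intro b
    have h1 : HasFDerivAt (fun b => a - b)
        (-ContinuousLinearMap.id ℝ (EuclideanSpace ℝ (Fin n))) b := (hasFDerivAt_id b).const_sub a
    have h2 := (hf1.differentiable (by norm_num) (a - b)).hasFDerivAt.comp b h1
    have h3 : fderiv ℝ ψ b = _ := h2.fderiv
    rw [h3]
    simp
  have hint := (hfc.fderiv ℝ).convolutionExists_left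
    (ContinuousLinearMap.precompL (EuclideanSpace ℝ (Fin n)) (ContinuousLinearMap.lsmul ℝ ℝ))
    (hf1.continuous_fderiv (by norm_num)) hvl a
  have key : (fderiv ℝ f ⋆[ContinuousLinearMap.precompL (EuclideanSpace ℝ (Fin n))
        (ContinuousLinearMap.lsmul ℝ ℝ), volume] v) a e = ∫ b in D, inner ℝ (g b) e * ψ b := by
    rw [convolution_def, ContinuousLinearMap.integral_apply hint]
    simp only [ContinuousLinearMap.precompL_apply, ContinuousLinearMap.lsmul_apply, smul_eq_mul]
    have e1 := integral_sub_left_eq_self (fun b => fderiv ℝ f (a - b) e * v b) volume a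
    simp only [sub_sub_cancel] at e1
    rw [e1]
    have e2 := h.integral_eq ψ hψs hψc (hψt.trans (ha.trans hKD)) e
    rw [← neg_eq_iff_eq_neg] at e2
    rw [← e2, ← integral_indicator hD, ← integral_neg]
    refine integral_congr_ae (Eventually.of_forall fun b => ?_)
    by_cases hb : b ∈ K
    · simp [hv, hb, hKD hb, hψd, mul_comm]
    · have hb0 : fderiv ℝ ψ b = 0 := by
        by_contra hne
        exact hb (ha (hψt (support_fderiv_subset ℝ hne)))
      by_cases hbD : b ∈ D <;> simp [hv, hb, hb0, hbD]
  rw [key]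
  refine (enorm_integral_le_lintegral_enorm _).trans ?_
  rw [hC, ← lintegral_mul_const' _ _ enorm_ne_top]
  refine lintegral_mono fun b => ?_
  rw [enorm_mul]
  have : ‖(inner ℝ (g b) e : ℝ)‖ₑ ≤ ‖g b‖ₑ * ‖e‖ₑ := by
    rw [← ofReal_norm, ← ofReal_norm, ← ofReal_norm, ← ENNReal.ofReal_mul (norm_nonneg _)]
    exact ENNReal.ofReal_le_ofReal (norm_inner_le_norm _ _)
  calc ‖(inner ℝ (g b) e : ℝ)‖ₑ * ‖ψ b‖ₑ ≤ (‖g b‖ₑ * ‖e‖ₑ) * ‖ψ b‖ₑ := by gcongr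
    _ = ‖g b‖ₑ * ‖f (a - b)‖ₑ * ‖e‖ₑ := by ring

open scoped Convolution in
/-- Integrated form over a ball of the estimate for the gradient of a mollification. -/
theorem HasWeakGradientOn.lintegral_fderiv_convolution_le (h : HasWeakGradientOn D u g)
    (hD : MeasurableSet D) {x : EuclideanSpace ℝ (Fin n)} {ρ ρ' r : ℝ}
    (hr : Metric.ball x r ⊆ D) (hρr : ρ' < r)
    (φ : ContDiffBump (0 : EuclideanSpace ℝ (Fin n))) (hφ : ρ + φ.rOut ≤ ρ') :
    ∫⁻ a in Metric.ball x ρ, ‖fderiv ℝ (φ.normed volume ⋆[ContinuousLinearMap.lsmul ℝ ℝ, volume]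
        ((Metric.closedBall x ρ').indicator u)) a‖ₑ
      ≤ ∫⁻ b in Metric.ball x r, ‖g b‖ₑ := by
  set f := φ.normed (volume : Measure (EuclideanSpace ℝ (Fin n))) with hf
  have hKD : Metric.closedBall x ρ' ⊆ D := (Metric.closedBall_subset_ball hρr).trans hr
  have hg : AEStronglyMeasurable g (volume.restrict D) :=
    h.locallyIntegrable_grad.aestronglyMeasurable
  have hsupp : ∀ a ∈ Metric.ball x ρ, ∀ b, f (a - b) ≠ 0 → b ∈ Metric.ball x r := by
    intro a ha b hb
    have h1 : a - b ∈ Function.support f := hb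
    rw [hf, φ.support_normed_eq, mem_ball_zero_iff, ← dist_eq_norm] at h1
    rw [Metric.mem_ball] at ha ⊢
    linarith [dist_triangle b a x, dist_comm a b]
  calc ∫⁻ a in Metric.ball x ρ, ‖fderiv ℝ (f ⋆[ContinuousLinearMap.lsmul ℝ ℝ, volume]
        ((Metric.closedBall x ρ').indicator u)) a‖ₑ
      ≤ ∫⁻ a in Metric.ball x ρ, ∫⁻ b in D, ‖g b‖ₑ * ‖f (a - b)‖ₑ := by
        refine setLIntegral_mono' measurableSet_ball fun a ha => ?_
        refine h.enorm_fderiv_convolution_le hD (isCompact_closedBall _ _) hKD φ fun b hb => ?_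
        rw [Metric.mem_ball] at ha
        rw [Metric.mem_closedBall] at hb ⊢
        linarith [dist_triangle b a x]
    _ = ∫⁻ a in Metric.ball x ρ, ∫⁻ b in Metric.ball x r, ‖g b‖ₑ * ‖f (a - b)‖ₑ := by
        refine setLIntegral_congr_fun measurableSet_ball fun a ha => ?_
        beta_reduce
        rw [← lintegral_indicator hD, ← lintegral_indicator measurableSet_ball]
        refine lintegral_congr fun b => ?_
        by_cases hb : f (a - b) = 0
        · have h0 : ‖g b‖ₑ * ‖f (a - b)‖ₑ = 0 := by rw [hb, enorm_zero, mul_zero]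
          simp only [Set.indicator, h0, ite_self]
        · have := hsupp a ha b hb
          simp [this, hr this]
    _ = ∫⁻ b in Metric.ball x r, ∫⁻ a in Metric.ball x ρ, ‖g b‖ₑ * ‖f (a - b)‖ₑ := by
        refine lintegral_lintegral_swap ?_
        have hfc : Continuous f := φ.contDiff_normed (n := 0).continuous
        have m1 : AEMeasurable (fun p : EuclideanSpace ℝ (Fin n) × EuclideanSpace ℝ (Fin n) =>
            ‖g p.2‖ₑ) ((volume.restrict (Metric.ball x ρ)).prod
              (volume.restrict (Metric.ball x r))) :=
          (hg.mono_measure (Measure.restrict_mono hr le_rfl)).enorm.comp_snd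
        have m2 : AEMeasurable (fun p : EuclideanSpace ℝ (Fin n) × EuclideanSpace ℝ (Fin n) =>
            ‖f (p.1 - p.2)‖ₑ) ((volume.restrict (Metric.ball x ρ)).prod
              (volume.restrict (Metric.ball x r))) :=
          (Continuous.enorm (by fun_prop)).measurable.aemeasurable
        exact m1.mul m2
    _ ≤ ∫⁻ b in Metric.ball x r, ‖g b‖ₑ := by
        refine lintegral_mono fun b => ?_
        rw [lintegral_const_mul' _ _ enorm_ne_top]
        refine mul_le_of_le_one_right' ?_
        calc ∫⁻ a in Metric.ball x ρ, ‖f (a - b)‖ₑ ≤ ∫⁻ a, ‖f (a - b)‖ₑ := setLIntegral_le_lintegral _ _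
          _ = ∫⁻ a, ‖f a‖ₑ := lintegral_sub_right_eq_self (fun a => ‖f a‖ₑ) b
          _ = ENNReal.ofReal (∫ a, f a) := by
              rw [ofReal_integral_eq_lintegral_ofReal φ.integrable_normed
                (Eventually.of_forall φ.nonneg_normed)]
              exact lintegral_congr fun a => Real.enorm_of_nonneg (φ.nonneg_normed a)
          _ = 1 := by rw [hf, φ.integral_normed]; simp

-- Mollifications of `u`, cut off to an intermediate ball, converge almost everywhere, so Fatou's
-- lemma carries the `C¹` inequality over. The gap between `ρ` and `r` is room for the mollifier; it
-- does not enter the constant.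
open scoped Convolution in
theorem HasWeakGradientOn.lintegral_ball_sub_le_of_lt (h : HasWeakGradientOn D u g)
    (hD : MeasurableSet D) {x : EuclideanSpace ℝ (Fin n)} {ρ r : ℝ}
    (hr : Metric.ball x r ⊆ D) (hρr : ρ < r) :
    ∫⁻ p in Metric.ball x ρ ×ˢ Metric.ball x ρ, ‖u p.1 - u p.2‖ₑ ∂(volume.prod volume)
      ≤ 2 ^ (n + 1) * ENNReal.ofReal r * volume (Metric.ball x r) *
        ∫⁻ y in Metric.ball x r, ‖g y‖ₑ := by
  obtain ⟨ρ', h1, h2⟩ := exists_between hρr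
  set v := (Metric.closedBall x ρ').indicator u with hv
  have hKD : Metric.closedBall x ρ' ⊆ D := (Metric.closedBall_subset_ball h2).trans hr
  have hvl : LocallyIntegrable v volume :=
    (((h.locallyIntegrable.mono_set hKD).integrableOn_isCompact
      (isCompact_closedBall _ _)).integrable_indicator measurableSet_closedBall).locallyIntegrable
  set ε : ℕ → ℝ := fun k => (ρ' - ρ) / (k + 1) with hε
  have hεpos : ∀ k, 0 < ε k := fun k => div_pos (by linarith) (by positivity)
  have hεle : ∀ k, ε k ≤ ρ' - ρ := fun k =>
    div_le_self (by linarith) (by have : (0 : ℝ) ≤ k := by positivity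
                                  linarith)
  have hεlim : Tendsto ε atTop (𝓝 0) := by
    have := (tendsto_one_div_add_atTop_nhds_zero_nat (𝕜 := ℝ)).const_mul (ρ' - ρ)
    simpa [hε, div_eq_mul_inv] using this
  -- Almost everywhere convergence needs a bounded ratio of outer to inner radius; here it is 2.
  let φ : ℕ → ContDiffBump (0 : EuclideanSpace ℝ (Fin n)) := fun k =>
    ⟨ε k / 2, ε k, half_pos (hεpos k), half_lt_self (hεpos k)⟩
  set w : ℕ → EuclideanSpace ℝ (Fin n) → ℝ := fun k =>
    (φ k).normed volume ⋆[ContinuousLinearMap.lsmul ℝ ℝ, volume] v with hw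
  have hwC : ∀ k, ContDiff ℝ 1 (w k) := fun k =>
    (φ k).hasCompactSupport_normed.contDiff_convolution_left (n := 1) _
      ((φ k).contDiff_normed) hvl
  have hconv : ∀ᵐ y : EuclideanSpace ℝ (Fin n), Tendsto (fun k => w k y) atTop (𝓝 (v y)) :=
    ContDiffBump.ae_convolution_tendsto_right_of_locallyIntegrable (K := 2) hεlim
      (Eventually.of_forall fun k => by simp only [φ]; linarith) hvl
  set B := Metric.ball x ρ
  have hBm : MeasurableSet (B ×ˢ B) := measurableSet_ball.prod measurableSet_ball
  have hae : ∀ᵐ p ∂((volume : Measure (EuclideanSpace ℝ (Fin n))).prod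
        (volume : Measure (EuclideanSpace ℝ (Fin n)))).restrict (B ×ˢ B),
      ‖u p.1 - u p.2‖ₑ ≤ liminf (fun k => ‖w k p.1 - w k p.2‖ₑ) atTop := by
    rw [ae_restrict_iff' hBm]
    filter_upwards [Measure.quasiMeasurePreserving_fst.ae hconv,
      Measure.quasiMeasurePreserving_snd.ae hconv] with p hp1 hp2 hpB
    have e1 : v p.1 = u p.1 := indicator_of_mem
      (Metric.closedBall_subset_closedBall h1.le (Metric.ball_subset_closedBall hpB.1)) u
    have e2 : v p.2 = u p.2 := indicator_of_mem
      (Metric.closedBall_subset_closedBall h1.le (Metric.ball_subset_closedBall hpB.2)) u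
    rw [← e1, ← e2]
    exact ((hp1.sub hp2).enorm).liminf_eq.ge
  calc ∫⁻ p in B ×ˢ B, ‖u p.1 - u p.2‖ₑ ∂(volume.prod volume)
      ≤ ∫⁻ p in B ×ˢ B, liminf (fun k => ‖w k p.1 - w k p.2‖ₑ) atTop ∂(volume.prod volume) :=
        lintegral_mono_ae hae
    _ ≤ liminf (fun k => ∫⁻ p in B ×ˢ B, ‖w k p.1 - w k p.2‖ₑ ∂(volume.prod volume)) atTop := by
        refine lintegral_liminf_le fun k => ?_
        have := (hwC k).continuous
        exact (Continuous.enorm (by fun_prop)).measurable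
    _ ≤ 2 ^ (n + 1) * ENNReal.ofReal r * volume (Metric.ball x r) *
        ∫⁻ y in Metric.ball x r, ‖g y‖ₑ := by
        refine liminf_le_of_le (by isBoundedDefault) fun b hb => ?_
        obtain ⟨k, hk⟩ := hb.exists
        refine hk.trans ((lintegral_ball_sub_le_of_contDiff volume (hwC k) x ρ).trans ?_)
        rw [finrank_euclideanSpace_fin]
        refine mul_le_mul' (by gcongr) ?_
        exact h.lintegral_fderiv_convolution_le (ρ := ρ) hD hr h2 (φ k)
          (by simp only [φ]; linarith [hεle k])

/-- The `L¹` Poincaré inequality on a ball for functions with a weak gradient; the ball may touch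
the boundary of the domain. -/
theorem HasWeakGradientOn.lintegral_ball_sub_le (h : HasWeakGradientOn D u g)
    (hD : MeasurableSet D) {x : EuclideanSpace ℝ (Fin n)} {r : ℝ}
    (hr : Metric.ball x r ⊆ D) (hr0 : 0 < r) :
    ∫⁻ p in Metric.ball x r ×ˢ Metric.ball x r, ‖u p.1 - u p.2‖ₑ ∂(volume.prod volume)
      ≤ 2 ^ (n + 1) * ENNReal.ofReal r * volume (Metric.ball x r) *
        ∫⁻ y in Metric.ball x r, ‖g y‖ₑ := by
  -- Since the constant is independent of the inner radius, monotone convergence along `ρ k ↑ r`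
  -- suffices, and no integrability of `u` up to the boundary is needed.
  set ρ : ℕ → ℝ := fun k => r - r / (k + 1) with hρ
  have hmono : Monotone ρ := by
    intro i j hij
    simp only [hρ]
    gcongr
  have hlt : ∀ k, ρ k < r := fun k => sub_lt_self _ (by positivity)
  have hlim : Tendsto ρ atTop (𝓝 r) := by
    have := ((tendsto_one_div_add_atTop_nhds_zero_nat (𝕜 := ℝ)).const_mul r).const_sub r
    simpa [hρ, div_eq_mul_inv] using this
  have hU : Metric.ball x r ×ˢ Metric.ball x r
      = ⋃ k, Metric.ball x (ρ k) ×ˢ Metric.ball x (ρ k) := by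
    ext p
    simp only [mem_prod, Metric.mem_ball, mem_iUnion]
    constructor
    · rintro ⟨hp1, hp2⟩
      exact ((hlim.eventually_const_lt hp1).and (hlim.eventually_const_lt hp2)).exists
    · rintro ⟨k, hp1, hp2⟩
      exact ⟨hp1.trans (hlt k), hp2.trans (hlt k)⟩
  rw [hU, setLIntegral_iUnion_of_directed]
  · exact iSup_le fun k => h.lintegral_ball_sub_le_of_lt hD hr (hlt k)
  · refine Monotone.directed_le fun i j hij => ?_
    exact prod_mono (Metric.ball_subset_ball (hmono hij)) (Metric.ball_subset_ball (hmono hij))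

end WeakPoincare

/-! ### Averages, bounded overlap and chains without shortcuts -/

theorem edist_setAverage_le {X : Type*} [MeasurableSpace X] {μ : Measure X} {B : Set X}
    (hB0 : μ B ≠ 0) (hBt : μ B ≠ ⊤) {f : X → ℝ} (hf : IntegrableOn f B μ) (c : ℝ) :
    edist c (⨍ z in B, f z ∂μ) ≤ (μ B)⁻¹ * ∫⁻ z in B, ‖c - f z‖ₑ ∂μ := by
  have hfin : IsFiniteMeasure (μ.restrict B) := ⟨by simpa using hBt.lt_top⟩
  have hne : NeZero (μ.restrict B) := ⟨by simpa [Measure.restrict_eq_zero] using hB0⟩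
  have h1 : Integrable f ((μ.restrict B univ)⁻¹ • μ.restrict B) :=
    hf.smul_measure (by simpa using hB0)
  have h2 : c - ⨍ z in B, f z ∂μ
      = ∫ z, (c - f z) ∂((μ.restrict B univ)⁻¹ • μ.restrict B) := by
    rw [integral_sub (integrable_const _) h1]
    simp [average]
    rw [measureReal_def, inv_mul_cancel₀ (ENNReal.toReal_ne_zero.2 ⟨hB0, hBt⟩), one_mul]
  rw [edist_eq_enorm_sub, h2]
  refine (enorm_integral_le_lintegral_enorm _).trans ?_
  rw [lintegral_smul_measure, Measure.restrict_apply_univ, smul_eq_mul]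

/-- Each point is counted at most `N` times. -/
theorem sum_setLIntegral_le_of_card_le {X ι : Type*} [MeasurableSpace X] {μ : Measure X}
    {U : Set X} {F : X → ℝ≥0∞} (hF : AEMeasurable F (μ.restrict U))
    (I : Finset ι) {B : ι → Set X} (hB : ∀ i, MeasurableSet (B i)) (hBU : ∀ i ∈ I, B i ⊆ U)
    (N : ℕ) (hN : ∀ z, ∀ J ⊆ I, (∀ i ∈ J, z ∈ B i) → J.card ≤ N) :
    ∑ i ∈ I, ∫⁻ z in B i, F z ∂μ ≤ N * ∫⁻ z in U, F z ∂μ := by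
  classical
  calc ∑ i ∈ I, ∫⁻ z in B i, F z ∂μ = ∑ i ∈ I, ∫⁻ z in U, (B i).indicator F z ∂μ := by
        refine Finset.sum_congr rfl fun i hi => ?_
        rw [setLIntegral_indicator (hB i), inter_eq_left.2 (hBU i hi)]
    _ = ∫⁻ z in U, ∑ i ∈ I, (B i).indicator F z ∂μ :=
        (lintegral_finsetSum' _ fun i _ => hF.indicator (hB i)).symm
    _ ≤ ∫⁻ z in U, N * F z ∂μ := by
        refine lintegral_mono fun z => ?_
        calc ∑ i ∈ I, (B i).indicator F z = ∑ i ∈ I with z ∈ B i, F z := by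
              rw [Finset.sum_filter]
              exact Finset.sum_congr rfl fun i _ => by simp [indicator_apply]
          _ = ((I.filter fun i => z ∈ B i).card : ℝ≥0∞) * F z := by simp
          _ ≤ N * F z := by
              gcongr
              exact hN z _ (Finset.filter_subset _ _) fun i hi => (Finset.mem_filter.1 hi).2
    _ = N * ∫⁻ z in U, F z ∂μ := lintegral_const_mul' _ _ (by simp)

/-- A chain of shortest length has no shortcuts. -/
theorem exists_chain_without_shortcut {X : Type*} [PseudoMetricSpace X] {S : Set X} {ρ : ℝ}
    {p q : X} (h : ∃ (m : ℕ) (c : ℕ → X), c 0 = p ∧ c m = q ∧ (∀ i ≤ m, c i ∈ S) ∧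
      ∀ i < m, dist (c i) (c (i + 1)) ≤ ρ) :
    ∃ (m : ℕ) (c : ℕ → X), c 0 = p ∧ c m = q ∧ (∀ i ≤ m, c i ∈ S) ∧
      (∀ i < m, dist (c i) (c (i + 1)) ≤ ρ) ∧
      ∀ i k, i + 2 ≤ k → k ≤ m → ρ < dist (c i) (c k) := by
  classical
  obtain ⟨c, h0, hm, hS, hd⟩ := Nat.find_spec h
  refine ⟨Nat.find h, c, h0, hm, hS, hd, fun i k hik hk => ?_⟩
  by_contra! hle
  have hlt : Nat.find h - (k - i - 1) < Nat.find h := by omega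
  -- Deleting the indices strictly between `i` and `k` leaves a shorter chain, against minimality.
  refine Nat.find_min h hlt ⟨fun l => if l ≤ i then c l else c (l + (k - i - 1)), ?_, ?_, ?_, ?_⟩
  · simp [h0]
  · have : ¬ (Nat.find h - (k - i - 1) ≤ i) := by omega
    have e : Nat.find h - (k - i - 1) + (k - i - 1) = Nat.find h := by omega
    simp only [this, if_false, e, hm]
  · intro l hl
    by_cases hli : l ≤ i
    · simpa [hli] using hS l (by omega)
    · simpa [hli] using hS (l + (k - i - 1)) (by omega)
  · intro l hl
    by_cases hli : l + 1 ≤ i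
    · have : l ≤ i := by omega
      simpa [hli, this] using hd l (by omega)
    · by_cases hli' : l ≤ i
      · have e1 : l = i := by omega
        have e2 : l + 1 + (k - i - 1) = k := by omega
        simp only [hli, hli', if_true, if_false, e2]
        rw [e1]; exact hle
      · have e2 : l + 1 + (k - i - 1) = l + (k - i - 1) + 1 := by omega
        simp only [hli, hli', if_false, e2]
        exact hd _ (by omega)

/-- Rescaled by `ρ⁻¹` about `z`, the centres are 1-separated points of the ball of radius 2, and the
volume count from the Besicovitch covering theorem applies. -/
theorem card_le_of_separated_of_dist_lt {E : Type*} [NormedAddCommGroup E] [NormedSpace ℝ E]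
    [FiniteDimensional ℝ E] {ρ : ℝ} (hρ : 0 < ρ) (z : E) {c : ℕ → E} (J : Finset ℕ)
    (hz : ∀ i ∈ J, dist z (c i) < 2 * ρ)
    (hsep : ∀ i ∈ J, ∀ k ∈ J, i ≠ k → ρ < dist (c i) (c k)) :
    J.card ≤ 5 ^ Module.finrank ℝ E := by
  classical
  set F : ℕ → E := fun i => ρ⁻¹ • (c i - z) with hF
  have hdist : ∀ i k, ‖F i - F k‖ = ρ⁻¹ * dist (c i) (c k) := by
    intro i k
    simp only [hF]
    rw [← smul_sub, norm_smul, sub_sub_sub_cancel_right, Real.norm_of_nonneg (by positivity),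
      dist_eq_norm]
  have hsep1 : ∀ i ∈ J, ∀ k ∈ J, i ≠ k → 1 < ‖F i - F k‖ := by
    intro i hi k hk hik
    rw [hdist, inv_mul_eq_div, one_lt_div hρ]
    exact hsep i hi k hk hik
  have hinj : Set.InjOn F J := by
    intro i hi k hk hik
    by_contra hne
    have := hsep1 i hi k hk hne
    rw [hik, sub_self, norm_zero] at this
    linarith
  rw [← Finset.card_image_of_injOn hinj]
  refine Besicovitch.card_le_of_separated _ ?_ ?_
  · intro d hd
    obtain ⟨i, hi, rfl⟩ := Finset.mem_image.1 hd
    simp only [hF]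
    rw [norm_smul, Real.norm_of_nonneg (by positivity), inv_mul_eq_div, div_le_iff₀ hρ,
      ← dist_eq_norm, dist_comm]
    exact (hz i hi).le
  · intro d hd e he hde
    obtain ⟨i, hi, rfl⟩ := Finset.mem_image.1 hd
    obtain ⟨k, hk, rfl⟩ := Finset.mem_image.1 he
    exact (hsep1 i hi k hk fun hik => hde (by rw [hik])).le

/-- Neighbouring centres may be close, but distinct indices of equal parity differ by at least 2 and
so have separated centres. The two parity classes give the factor 2. -/
theorem card_le_of_chain_without_shortcut {E : Type*} [NormedAddCommGroup E] [NormedSpace ℝ E]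
    [FiniteDimensional ℝ E] {ρ : ℝ} (hρ : 0 < ρ) (z : E) {c : ℕ → E} {m : ℕ}
    (hsep : ∀ i k, i + 2 ≤ k → k ≤ m → ρ < dist (c i) (c k)) (J : Finset ℕ)
    (hJ : J ⊆ Finset.range m) (hz : ∀ i ∈ J, dist z (c i) < 2 * ρ) :
    J.card ≤ 2 * 5 ^ Module.finrank ℝ E := by
  have hpar : ∀ P : ℕ → Prop, [DecidablePred P] → (∀ i k, P i → P k → i ≠ k → i % 2 = k % 2) →
      (J.filter P).card ≤ 5 ^ Module.finrank ℝ E := by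
    intro P _ hP
    refine card_le_of_separated_of_dist_lt hρ z _ (fun i hi => hz i (Finset.mem_filter.1 hi).1) ?_
    intro i hi k hk hik
    have hi' := Finset.mem_filter.1 hi
    have hk' := Finset.mem_filter.1 hk
    have him := Finset.mem_range.1 (hJ hi'.1)
    have hkm := Finset.mem_range.1 (hJ hk'.1)
    have := hP i k hi'.2 hk'.2 hik
    rcases lt_or_gt_of_ne hik with hlt | hlt
    · exact hsep i k (by omega) hkm.le
    · rw [dist_comm]
      exact hsep k i (by omega) him.le
  have h1 := hpar (fun i => i % 2 = 0) (fun i k hi hk _ => by rw [hi, hk])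
  have h2 := hpar (fun i => ¬ i % 2 = 0) (fun i k hi hk _ => by omega)
  have := Finset.card_filter_add_card_filter_not (s := J) (fun i => i % 2 = 0)
  omega

/-! ### Comparison of averages over balls and along curves -/

section Averages

variable {n : ℕ} {D : Set (EuclideanSpace ℝ (Fin n))} {u : EuclideanSpace ℝ (Fin n) → ℝ}
  {g : EuclideanSpace ℝ (Fin n) → EuclideanSpace ℝ (Fin n)}

theorem HasWeakGradientOn.lintegral_lintegral_ball_sub_le (h : HasWeakGradientOn D u g)
    (hD : MeasurableSet D) {x : EuclideanSpace ℝ (Fin n)} {r : ℝ}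
    (hr : Metric.ball x r ⊆ D) (hr0 : 0 < r) :
    ∫⁻ y in Metric.ball x r, ∫⁻ z in Metric.ball x r, ‖u y - u z‖ₑ
      ≤ 2 ^ (n + 1) * ENNReal.ofReal r * volume (Metric.ball x r) *
        ∫⁻ y in Metric.ball x r, ‖g y‖ₑ := by
  refine le_trans (le_of_eq ?_) (h.lintegral_ball_sub_le hD hr hr0)
  have hu : AEStronglyMeasurable u (volume.restrict (Metric.ball x r)) :=
    h.locallyIntegrable.aestronglyMeasurable.mono_measure (Measure.restrict_mono hr le_rfl)
  rw [← Measure.prod_restrict, lintegral_prod]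
  exact (hu.comp_fst.sub hu.comp_snd).enorm

/-- Local integrability says nothing near the boundary of `D`, which the ball may touch. The
Poincaré inequality makes the double integral of `|u y - u z|` finite, so `z ↦ u y - u z` is
integrable for some `y`. -/
theorem HasWeakGradientOn.integrableOn_ball (h : HasWeakGradientOn D u g)
    (hD : MeasurableSet D) {x : EuclideanSpace ℝ (Fin n)} {r : ℝ}
    (hr : Metric.ball x r ⊆ D) (hr0 : 0 < r)
    (hg : ∫⁻ y in Metric.ball x r, ‖g y‖ₑ ≠ ⊤) : IntegrableOn u (Metric.ball x r) := by
  have hu : AEStronglyMeasurable u (volume.restrict (Metric.ball x r)) :=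
    h.locallyIntegrable.aestronglyMeasurable.mono_measure (Measure.restrict_mono hr le_rfl)
  have hB : volume (Metric.ball x r) ≠ ⊤ := measure_ball_lt_top.ne
  have hfin : ∫⁻ y in Metric.ball x r, ∫⁻ z in Metric.ball x r, ‖u y - u z‖ₑ ≠ ⊤ := by
    refine ne_top_of_le_ne_top ?_ (h.lintegral_lintegral_ball_sub_le hD hr hr0)
    finiteness
  have hm : AEMeasurable (fun y => ∫⁻ z in Metric.ball x r, ‖u y - u z‖ₑ)
      (volume.restrict (Metric.ball x r)) :=
    ((hu.comp_fst.sub hu.comp_snd).enorm :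
      AEMeasurable (fun p : EuclideanSpace ℝ (Fin n) × EuclideanSpace ℝ (Fin n) =>
        ‖u p.1 - u p.2‖ₑ) ((volume.restrict (Metric.ball x r)).prod
          (volume.restrict (Metric.ball x r)))).lintegral_prod_right'
  have hae := ae_lt_top' hm hfin
  have hne : (ae (volume.restrict (Metric.ball x r))).NeBot := by
    rw [ae_neBot, Ne, Measure.restrict_eq_zero]
    exact (Metric.measure_ball_pos volume x hr0).ne'
  obtain ⟨y, hy⟩ := hae.exists
  have h1 : IntegrableOn (fun z => u y - u z) (Metric.ball x r) :=
    ⟨aestronglyMeasurable_const.sub hu, hy⟩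
  have h2 : IntegrableOn (fun _ => u y) (Metric.ball x r) := integrableOn_const hB
  refine (h2.sub h1).congr (Eventually.of_forall fun z => ?_)
  simp

/-- Comparison of the averages over a ball of the domain and over a smaller ball in it. -/
theorem HasWeakGradientOn.edist_average_le (h : HasWeakGradientOn D u g)
    (hD : MeasurableSet D) {p q : EuclideanSpace ℝ (Fin n)} {r r' : ℝ}
    (hr : Metric.ball p r ⊆ D) (hr'0 : 0 < r') (hsub : Metric.ball q r' ⊆ Metric.ball p r) :
    edist (⨍ y in Metric.ball p r, u y) (⨍ y in Metric.ball q r', u y)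
      ≤ 2 ^ (n + 1) * ENNReal.ofReal r * (volume (Metric.ball q r'))⁻¹ *
        ∫⁻ y in Metric.ball p r, ‖g y‖ₑ := by
  have hr0 : 0 < r := by
    by_contra hcon
    rw [Metric.ball_eq_empty.2 (not_lt.1 hcon)] at hsub
    exact hsub (Metric.mem_ball_self hr'0)
  set V := volume (Metric.ball p r)
  set V' := volume (Metric.ball q r')
  have hV0 : V ≠ 0 := (Metric.measure_ball_pos volume p hr0).ne'
  have hVt : V ≠ ⊤ := measure_ball_lt_top.ne
  have hV'0 : V' ≠ 0 := (Metric.measure_ball_pos volume q hr'0).ne'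
  have hV't : V' ≠ ⊤ := measure_ball_lt_top.ne
  -- If the gradient integral is infinite the bound is trivial; otherwise `u` is integrable on the
  -- ball and the averages are genuine.
  by_cases hg : ∫⁻ y in Metric.ball p r, ‖g y‖ₑ = ⊤
  · rw [hg, ENNReal.mul_top]
    · exact le_top
    · have : ENNReal.ofReal r ≠ 0 := by simpa using hr0
      have : V'⁻¹ ≠ 0 := by simpa using hV't
      positivity
  · have hu := h.integrableOn_ball hD hr hr0 hg
    refine (edist_setAverage_le hV'0 hV't (hu.mono_set hsub) _).trans ?_
    calc V'⁻¹ * ∫⁻ y in Metric.ball q r', ‖(⨍ z in Metric.ball p r, u z) - u y‖ₑ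
        ≤ V'⁻¹ * ∫⁻ y in Metric.ball p r, V⁻¹ * ∫⁻ z in Metric.ball p r, ‖u y - u z‖ₑ := by
          refine mul_le_mul' le_rfl ?_
          refine (lintegral_mono_set hsub).trans (lintegral_mono fun y => ?_)
          rw [← edist_eq_enorm_sub, edist_comm]
          exact edist_setAverage_le hV0 hVt hu (u y)
      _ = V'⁻¹ * (V⁻¹ * ∫⁻ y in Metric.ball p r, ∫⁻ z in Metric.ball p r, ‖u y - u z‖ₑ) := by
          rw [lintegral_const_mul' _ _ (by simpa using hV0)]
      _ ≤ V'⁻¹ * (V⁻¹ * (2 ^ (n + 1) * ENNReal.ofReal r * V *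
            ∫⁻ y in Metric.ball p r, ‖g y‖ₑ)) := by
          refine mul_le_mul' le_rfl (mul_le_mul' le_rfl ?_)
          exact h.lintegral_lintegral_ball_sub_le hD hr hr0
      _ = (V⁻¹ * V) * (2 ^ (n + 1) * ENNReal.ofReal r * V'⁻¹ *
            ∫⁻ y in Metric.ball p r, ‖g y‖ₑ) := by ring
      _ = _ := by rw [ENNReal.inv_mul_cancel hV0 hVt, one_mul]

/-- The averages over two balls of the same radius centred on a curve, when the tube around the
curve is contained in the domain. The bound does not depend on the length of the curve. -/
theorem HasWeakGradientOn.edist_average_curve_le (h : HasWeakGradientOn D u g)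
    (hD : MeasurableSet D) {γ : ℝ → EuclideanSpace ℝ (Fin n)} {a b ρ : ℝ} (hab : a ≤ b)
    (hρ : 0 < ρ) (hγ : ∀ s ∈ Icc a b, ∀ t ∈ Icc a b, dist (γ s) (γ t) ≤ |s - t|)
    {U : Set (EuclideanSpace ℝ (Fin n))} (hUD : U ⊆ D)
    (hball : ∀ t ∈ Icc a b, Metric.ball (γ t) (2 * ρ) ⊆ U) :
    edist (⨍ y in Metric.ball (γ a) ρ, u y) (⨍ y in Metric.ball (γ b) ρ, u y)
      ≤ (2 ^ (n + 4) * 5 ^ n) * ENNReal.ofReal ρ *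
        (volume (Metric.ball (0 : EuclideanSpace ℝ (Fin n)) ρ))⁻¹ * ∫⁻ y in U, ‖g y‖ₑ := by
  set V := volume (Metric.ball (0 : EuclideanSpace ℝ (Fin n)) ρ)
  have hVc : ∀ q : EuclideanSpace ℝ (Fin n), volume (Metric.ball q ρ) = V := fun q =>
    Measure.addHaar_ball_center volume q ρ
  -- Any subdivision of mesh at most `ρ` serves; its number of points is lost when shortcuts are
  -- removed.
  have hchain : ∃ (m : ℕ) (c : ℕ → EuclideanSpace ℝ (Fin n)), c 0 = γ a ∧ c m = γ b ∧
      (∀ i ≤ m, c i ∈ γ '' Icc a b) ∧ ∀ i < m, dist (c i) (c (i + 1)) ≤ ρ := by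
    obtain ⟨m, hm⟩ := exists_nat_ge ((b - a) / ρ)
    have hm0 : (0 : ℝ) < m + 1 := by positivity
    have hstep : (b - a) / (m + 1) ≤ ρ := by
      rw [div_le_iff₀ hm0]
      rw [div_le_iff₀ hρ] at hm
      nlinarith
    have hmem : ∀ i ≤ m + 1, a + i * ((b - a) / (m + 1)) ∈ Icc a b := by
      intro i hi
      have hi' : (i : ℝ) ≤ m + 1 := by exact_mod_cast hi
      have h0 : 0 ≤ (b - a) / (m + 1) := div_nonneg (by linarith) hm0.le
      refine ⟨by nlinarith [mul_nonneg (Nat.cast_nonneg (α := ℝ) i) h0], ?_⟩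
      have : (i : ℝ) * ((b - a) / (m + 1)) ≤ (m + 1) * ((b - a) / (m + 1)) := by gcongr
      rw [mul_div_cancel₀ _ hm0.ne'] at this
      linarith
    refine ⟨m + 1, fun i => γ (a + i * ((b - a) / (m + 1))), by simp, ?_, ?_, ?_⟩
    · push_cast
      rw [mul_div_cancel₀ _ hm0.ne', add_sub_cancel]
    · exact fun i hi => mem_image_of_mem _ (hmem i hi)
    · intro i hi
      refine (hγ _ (hmem i hi.le) _ (hmem (i + 1) hi)).trans ?_
      push_cast
      rw [show a + i * ((b - a) / (m + 1)) - (a + (i + 1) * ((b - a) / (m + 1)))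
        = -((b - a) / (m + 1)) by ring, abs_neg, abs_of_nonneg (div_nonneg (by linarith) hm0.le)]
      exact hstep
  obtain ⟨m, c, h0, hm, hS, hd, hsep⟩ := exists_chain_without_shortcut hchain
  have hcU : ∀ i ≤ m, Metric.ball (c i) (2 * ρ) ⊆ U := by
    intro i hi
    obtain ⟨t, ht, hti⟩ := hS i hi
    rw [← hti]
    exact hball t ht
  -- Both averages are compared with the one over `B(c i, 2ρ)`, which contains both balls.
  have hone : ∀ i < m, edist (⨍ y in Metric.ball (c i) ρ, u y) (⨍ y in Metric.ball (c (i + 1)) ρ, u y)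
      ≤ 2 ^ (n + 3) * ENNReal.ofReal ρ * V⁻¹ * ∫⁻ y in Metric.ball (c i) (2 * ρ), ‖g y‖ₑ := by
    intro i hi
    have e1 := h.edist_average_le hD (p := c i) (q := c i) ((hcU i hi.le).trans hUD) hρ
      (Metric.ball_subset_ball (by linarith))
    have e2 := h.edist_average_le hD (p := c i) (q := c (i + 1)) ((hcU i hi.le).trans hUD) hρ
      (Metric.ball_subset_ball' (by have := hd i hi; rw [dist_comm] at this; linarith))
    rw [hVc] at e1 e2
    rw [edist_comm] at e1
    refine ((edist_triangle _ _ _).trans (add_le_add e1 e2)).trans (le_of_eq ?_)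
    rw [ENNReal.ofReal_mul (by norm_num), ENNReal.ofReal_ofNat]
    ring
  rw [← h0, ← hm]
  refine (edist_le_range_sum_edist (fun i => ⨍ y in Metric.ball (c i) ρ, u y) m).trans ?_
  calc ∑ i ∈ Finset.range m, edist (⨍ y in Metric.ball (c i) ρ, u y)
          (⨍ y in Metric.ball (c (i + 1)) ρ, u y)
      ≤ ∑ i ∈ Finset.range m, 2 ^ (n + 3) * ENNReal.ofReal ρ * V⁻¹ *
          ∫⁻ y in Metric.ball (c i) (2 * ρ), ‖g y‖ₑ :=
        Finset.sum_le_sum fun i hi => hone i (Finset.mem_range.1 hi)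
    _ = 2 ^ (n + 3) * ENNReal.ofReal ρ * V⁻¹ *
          ∑ i ∈ Finset.range m, ∫⁻ y in Metric.ball (c i) (2 * ρ), ‖g y‖ₑ := by
        rw [Finset.mul_sum]
    _ ≤ 2 ^ (n + 3) * ENNReal.ofReal ρ * V⁻¹ * (((2 * 5 ^ n : ℕ) : ℝ≥0∞) * ∫⁻ y in U, ‖g y‖ₑ) := by
        refine mul_le_mul' le_rfl ?_
        refine sum_setLIntegral_le_of_card_le ?_ _ (fun i => measurableSet_ball) ?_ _ ?_
        · exact (h.locallyIntegrable_grad.aestronglyMeasurable.mono_measure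
            (Measure.restrict_mono hUD le_rfl)).enorm
        · exact fun i hi => hcU i (Finset.mem_range.1 hi).le
        · intro z J hJ hz
          have := card_le_of_chain_without_shortcut hρ z hsep J hJ hz
          rwa [finrank_euclideanSpace_fin] at this
    _ = _ := by
        push_cast
        ring

end Averages

/-! ### Geometry of John domains -/

/-- The ball is connected, meets `D` and misses the frontier. An empty frontier is harmless, as
`infDist` is then 0 and the ball is empty. -/
theorem ball_infDist_frontier_subset {E : Type*} [NormedAddCommGroup E] [NormedSpace ℝ E]
    {D : Set E} (hD : IsOpen D) {y : E} (hy : y ∈ D) :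
    Metric.ball y (Metric.infDist y (frontier D)) ⊆ D := by
  rcases le_or_gt (Metric.infDist y (frontier D)) 0 with h0 | h0
  · rw [Metric.ball_eq_empty.2 h0]; exact empty_subset _
  have hpre : IsPreconnected (Metric.ball y (Metric.infDist y (frontier D))) :=
    (convex_ball y _).isPreconnected
  refine hpre.subset_left_of_subset_union hD (isOpen_interior (s := Dᶜ)) ?_ ?_
    ⟨y, Metric.mem_ball_self h0, hy⟩
  · exact disjoint_compl_right.mono_right interior_subset
  · intro z hz
    have hzf : z ∉ frontier D := fun hzf => by
      have := Metric.infDist_le_dist_of_mem (x := y) hzf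
      rw [Metric.mem_ball'] at hz
      linarith
    by_cases hzD : z ∈ D
    · exact Or.inl hzD
    · right
      rw [interior_compl]
      intro hcl
      exact hzf ⟨hcl, by rwa [hD.interior_eq]⟩

/-- In a nontrivial space a bounded set is not everything, so the frontier is nonempty and `infDist`
does not take its default value 0. -/
theorem infDist_frontier_pos {E : Type*} [NormedAddCommGroup E] [NormedSpace ℝ E] [Nontrivial E]
    {D : Set E} (hD : IsOpen D) (hb : Bornology.IsBounded D) {y : E} (hy : y ∈ D) :
    0 < Metric.infDist y (frontier D) := by
  have hne : (frontier D).Nonempty := by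
    rw [nonempty_frontier_iff]
    refine ⟨⟨y, hy⟩, fun huniv => ?_⟩
    rw [huniv] at hb
    exact NormedSpace.unbounded_univ ℝ E hb
  refine (isClosed_frontier.notMem_iff_infDist_pos hne).1 fun hyf => ?_
  have : y ∈ D ∩ frontier D := ⟨hy, hyf⟩
  rw [hD.inter_frontier_eq] at this
  exact this

/-- The variation over `[t, t']` bounds the distance of the endpoints. This Lipschitz bound is all
that is needed of unit speed. -/
theorem HasUnitSpeedOn.dist_le {E : Type*} [PseudoMetricSpace E] {γ : ℝ → E} {L : ℝ}
    (h : HasUnitSpeedOn γ (Icc 0 L)) {t t' : ℝ} (ht : t ∈ Icc 0 L) (ht' : t' ∈ Icc 0 L) :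
    dist (γ t) (γ t') ≤ |t - t'| := by
  wlog hle : t ≤ t' generalizing t t'
  · rw [dist_comm, abs_sub_comm]
    exact this ht' ht (le_of_not_ge hle)
  have h1 := h ht ht'
  have h2 := eVariationOn.edist_le γ (s := Icc 0 L ∩ Icc t t') (x := t) (y := t')
    ⟨ht, left_mem_Icc.2 hle⟩ ⟨ht', right_mem_Icc.2 hle⟩
  rw [h1, edist_dist, ENNReal.ofReal_le_ofReal_iff (by simpa using hle)] at h2
  rw [abs_sub_comm, abs_of_nonneg (by linarith)]
  simpa using h2

/-- The curves of a John domain, all reparametrized to an interval of the same length by staying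
at the centre. -/
theorem IsVarJohnDomain.exists_curves {n : ℕ} [NeZero n] {D : Set (EuclideanSpace ℝ (Fin n))}
    {s : EuclideanSpace ℝ (Fin n) → ℝ} {x₀ : EuclideanSpace ℝ (Fin n)}
    (hD : IsVarJohnDomain D s x₀) (hs2 : ∀ x ∈ D, s x ≤ 2) :
    ∃ R K : ℝ, 1 ≤ R ∧ 1 ≤ K ∧ (∀ x ∈ D, D ⊆ Metric.ball x R) ∧
      ∀ x ∈ D, ∃ γ : ℝ → EuclideanSpace ℝ (Fin n),
        (∀ t ∈ Icc 0 R, ∀ t' ∈ Icc 0 R, dist (γ t) (γ t') ≤ |t - t'|) ∧ γ 0 = x ∧ γ R = x₀ ∧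
        ∀ t ∈ Icc 0 R, γ t ∈ D ∧ t ^ s x ≤ K * Metric.infDist (γ t) (frontier D) := by
  obtain ⟨a, b, h⟩ := hD
  set d₀ := Metric.infDist x₀ (frontier D) with hd₀
  have hd₀pos : 0 < d₀ := infDist_frontier_pos h.isOpen h.isBounded h.center_mem
  set R := max (max 1 b) (Metric.diam D + 1) with hR
  have hR1 : 1 ≤ R := (le_max_left _ _).trans (le_max_left _ _)
  have hRb : b ≤ R := (le_max_right _ _).trans (le_max_left _ _)
  have hRd : Metric.diam D + 1 ≤ R := le_max_right _ _
  -- The entry `R ^ 2 / d₀` covers the times at which the prolonged curve rests at `x₀`: there `t ^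
  -- s x ≤ R ^ 2`, as `s x ≤ 2` and `R ≥ 1`.
  set K := max (max 1 (b / a)) (R ^ 2 / d₀) with hK
  have hK1 : 1 ≤ K := (le_max_left _ _).trans (le_max_left _ _)
  have hKb : b / a ≤ K := (le_max_right _ _).trans (le_max_left _ _)
  have hKd : R ^ 2 / d₀ ≤ K := le_max_right _ _
  refine ⟨R, K, hR1, hK1, fun x hx y hy => ?_, fun x hx => ?_⟩
  · have := Metric.dist_le_diam_of_mem h.isBounded hy hx
    rw [Metric.mem_ball]
    linarith
  obtain ⟨L, γ, hL0, hLb, hsp, hmaps, hγ0, hγL, hJ⟩ := h.exists_curve x hx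
  have hmem : ∀ t ∈ Icc 0 R, min t L ∈ Icc 0 L := fun t ht => ⟨le_min ht.1 hL0, min_le_right _ _⟩
  refine ⟨fun t => γ (min t L), fun t ht t' ht' => ?_, ?_, ?_, fun t ht => ⟨?_, ?_⟩⟩
  · refine (hsp.dist_le (hmem t ht) (hmem t' ht')).trans ?_
    exact (abs_min_sub_min_le_max t L t' L).trans (by simp)
  · simp only [min_eq_left hL0, hγ0]
  · simp only [min_eq_right (hLb.trans hRb), hγL]
  · exact hmaps (hmem t ht)
  · rcases le_total t L with htL | htL
    · simp only [min_eq_left htL]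
      refine (hJ t ⟨ht.1, htL⟩).trans ?_
      gcongr
      exact Metric.infDist_nonneg
    · simp only [min_eq_right htL, hγL]
      have hs1 := h.one_le x hx
      calc t ^ s x ≤ R ^ s x := Real.rpow_le_rpow ht.1 ht.2 (by linarith)
        _ ≤ R ^ (2 : ℝ) := Real.rpow_le_rpow_of_exponent_le hR1 (hs2 x hx)
        _ = R ^ 2 := by norm_cast
        _ = R ^ 2 / d₀ * d₀ := by field_simp
        _ ≤ K * d₀ := by gcongr

/-! ### The precise representative and the pointwise potential bound -/

/-- Summability makes the dyadic values Cauchy, and every other radius is within `a j → 0` of a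
dyadic one. The start `j₀` is there because only small balls lie in the domain. -/
theorem exists_tendsto_nhdsGT_zero_of_dyadic {F : ℝ → ℝ} {r₀ : ℝ} (hr₀ : 0 < r₀)
    {a : ℕ → ℝ≥0∞} (ha : ∑' j, a j ≠ ⊤) {j₀ : ℕ}
    (hF : ∀ j ≥ j₀, ∀ r, r₀ * (1 / 2) ^ (j + 1) ≤ r → r ≤ r₀ * (1 / 2) ^ j →
      edist (F (r₀ * (1 / 2) ^ j)) (F r) ≤ a j) :
    ∃ l, Tendsto F (𝓝[>] 0) (𝓝 l) := by
  set f : ℕ → ℝ := fun k => F (r₀ * (1 / 2) ^ (k + j₀)) with hf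
  have hstep : ∀ k, edist (f k) (f k.succ) ≤ a (k + j₀) := by
    intro k
    have := hF (k + j₀) (by omega) (r₀ * (1 / 2) ^ (k + j₀ + 1)) le_rfl ?_
    · simpa [hf, Nat.succ_eq_add_one, add_right_comm] using this
    · gcongr r₀ * ?_
      exact pow_le_pow_of_le_one (by norm_num) (by norm_num) (by omega)
  have hsum : ∑' k, a (k + j₀) ≠ ⊤ :=
    ne_top_of_le_ne_top ha (ENNReal.tsum_comp_le_tsum_of_injective (add_left_injective j₀) a)
  have hC := cauchySeq_of_edist_le_of_tsum_ne_top _ hstep hsum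
  obtain ⟨l, hl⟩ := cauchySeq_tendsto_of_complete hC
  refine ⟨l, ?_⟩
  rw [EMetric.tendsto_nhds]
  intro ε hε
  have hε2 : 0 < ε / 2 := by simpa using hε.ne'
  have e1 := (EMetric.tendsto_nhds.1 hl) (ε / 2) hε2
  have e2 := (ENNReal.tendsto_atTop_zero_of_tsum_ne_top hsum).eventually_lt_const hε2
  obtain ⟨N, hN⟩ := eventually_atTop.1 (e1.and e2)
  have hpos : 0 < r₀ * (1 / 2 : ℝ) ^ (N + j₀) := by positivity
  filter_upwards [Ioo_mem_nhdsGT hpos] with r hr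
  obtain ⟨j, hj1, hj2⟩ := exists_nat_pow_near_of_lt_one (x := r / r₀) (y := (1 / 2 : ℝ))
    (div_pos hr.1 hr₀) (by
      rw [div_le_one hr₀]
      refine hr.2.le.trans (mul_le_of_le_one_right hr₀.le (pow_le_one₀ (by norm_num) (by norm_num))))
    (by norm_num) (by norm_num)
  rw [lt_div_iff₀' hr₀] at hj1
  rw [div_le_iff₀' hr₀] at hj2
  have hjN : N + j₀ ≤ j := by
    by_contra! hlt
    have : r₀ * (1 / 2 : ℝ) ^ (N + j₀) ≤ r₀ * (1 / 2) ^ (j + 1) := by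
      gcongr r₀ * ?_
      exact pow_le_pow_of_le_one (by norm_num) (by norm_num) (by omega)
    linarith [hr.2]
  obtain ⟨k, rfl⟩ : ∃ k, j = k + j₀ := ⟨j - j₀, by omega⟩
  obtain ⟨h1, h2⟩ := hN k (by omega)
  calc edist (F r) l ≤ edist (F r) (f k) + edist (f k) l := edist_triangle _ _ _
    _ < ε / 2 + ε / 2 := by
        refine ENNReal.add_lt_add ?_ h1
        rw [edist_comm]
        exact (hF (k + j₀) (by omega) r hj1.le hj2).trans_lt h2
    _ = ε := ENNReal.add_halves ε

theorem tendsto_preciseRep {E : Type*} [MetricSpace E] [MeasureSpace E] {u : E → ℝ} {x : E}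
    (h : ∃ l : ℝ, Tendsto (fun r : ℝ => ⨍ y in Metric.ball x r, u y) (𝓝[>] 0) (𝓝 l)) :
    Tendsto (fun r : ℝ => ⨍ y in Metric.ball x r, u y) (𝓝[>] 0) (𝓝 (preciseRep u x)) := by
  rw [preciseRep, dif_pos h]
  exact h.choose_spec

/-- A dyadic form of the Riesz potential of order `n - β` of `|g|` over `D`. -/
noncomputable def dyadicPotential {n : ℕ} (D : Set (EuclideanSpace ℝ (Fin n)))
    (g : EuclideanSpace ℝ (Fin n) → EuclideanSpace ℝ (Fin n)) (r₀ β : ℝ)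
    (x : EuclideanSpace ℝ (Fin n)) : ℝ≥0∞ :=
  ∑' j : ℕ, ENNReal.ofReal ((r₀ * (1 / 2) ^ j) ^ (-β)) *
    ∫⁻ y in D ∩ Metric.ball x (r₀ * (1 / 2) ^ j), ‖g y‖ₑ

theorem inv_volume_ball_eq {n : ℕ} (q : EuclideanSpace ℝ (Fin n)) {ρ : ℝ} (hρ : 0 < ρ) :
    (volume (Metric.ball q ρ))⁻¹ = ENNReal.ofReal ((ρ ^ n)⁻¹) *
      (volume (Metric.ball (0 : EuclideanSpace ℝ (Fin n)) 1))⁻¹ := by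
  rw [Measure.addHaar_ball_of_pos volume q hρ, finrank_euclideanSpace_fin,
    ENNReal.mul_inv (Or.inr measure_ball_lt_top.ne) (Or.inl ENNReal.ofReal_ne_top),
    ENNReal.ofReal_inv_of_pos (by positivity)]

/-- Here `ρ = (r / (2R)) ^ σ / (8K)` is the tube radius at scale `r`, and `ρ * ρ⁻ⁿ = ρ ^ (-m)` is
comparable to `r ^ (-(σ * m))`. As `8K` and `2R` are at least 1, raising their exponents makes the
constant independent of `σ ≤ 2`. -/
theorem rpow_div_mul_inv_pow_le {m : ℕ} {R K σ r : ℝ} (hR : 1 ≤ R) (hK : 1 ≤ K)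
    (hσ : σ ≤ 2) (hr : 0 < r) :
    (r / (2 * R)) ^ σ / (8 * K) * ((((r / (2 * R)) ^ σ / (8 * K)) ^ (m + 1))⁻¹)
      ≤ (8 * K) ^ (m + 1) * (2 * R) ^ (2 * (m + 1)) * r ^ (-(σ * m)) := by
  have hT : 0 < r / (2 * R) := by positivity
  have e1 : ((r / (2 * R)) ^ σ) ^ m = r ^ (σ * m) / (2 * R) ^ (σ * m) := by
    rw [← Real.rpow_natCast, ← Real.rpow_mul hT.le, Real.div_rpow hr.le (by positivity)]
  have hρ : 0 < (r / (2 * R)) ^ σ / (8 * K) := by positivity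
  calc (r / (2 * R)) ^ σ / (8 * K) * ((((r / (2 * R)) ^ σ / (8 * K)) ^ (m + 1))⁻¹)
      = (((r / (2 * R)) ^ σ / (8 * K)) ^ m)⁻¹ := by
        rw [pow_succ]; field_simp
    _ = (8 * K) ^ m * (2 * R) ^ (σ * m) * r ^ (-(σ * m)) := by
        rw [div_pow, e1, Real.rpow_neg hr.le]; field_simp
    _ ≤ (8 * K) ^ (m + 1) * (2 * R) ^ (2 * (m + 1)) * r ^ (-(σ * m)) := by
        gcongr
        · linarith
        · omega
        · rw [← Real.rpow_natCast]
          refine Real.rpow_le_rpow_of_exponent_le (by linarith) ?_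
          push_cast
          nlinarith [Nat.cast_nonneg (α := ℝ) m]

/-- The dyadic increments of the averages are at most a multiple of `r_j ^ (-m)` times the integral
of `|g|` over `B(x, r_j)`. As `σ ≥ 1`, these are dominated by the terms of the potential. -/
theorem exists_tendsto_average_of_dyadicPotential_ne_top {m : ℕ}
    {D : Set (EuclideanSpace ℝ (Fin (m + 1)))} {u : EuclideanSpace ℝ (Fin (m + 1)) → ℝ}
    {g : EuclideanSpace ℝ (Fin (m + 1)) → EuclideanSpace ℝ (Fin (m + 1))}
    (h : HasWeakGradientOn D u g) (hD : IsOpen D) {x : EuclideanSpace ℝ (Fin (m + 1))}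
    (hx : x ∈ D) {r₀ σ : ℝ} (hr₀ : 0 < r₀) (hσ : 1 ≤ σ)
    (hfin : dyadicPotential D g r₀ (σ * m) x ≠ ⊤) :
    ∃ l : ℝ, Tendsto (fun r : ℝ => ⨍ y in Metric.ball x r, u y) (𝓝[>] 0) (𝓝 l) := by
  set κ := volume (Metric.ball (0 : EuclideanSpace ℝ (Fin (m + 1))) 1) with hκ
  have hκ0 : κ⁻¹ ≠ ⊤ := by
    simpa using (Metric.measure_ball_pos volume (0 : EuclideanSpace ℝ (Fin (m + 1))) one_pos).ne'
  obtain ⟨d, hd, hdD⟩ := Metric.isOpen_iff.1 hD x hx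
  have hrlim : Tendsto (fun j : ℕ => r₀ * (1 / 2 : ℝ) ^ j) atTop (𝓝 0) := by
    simpa using (tendsto_pow_atTop_nhds_zero_of_lt_one (r := (1 / 2 : ℝ)) (by norm_num)
      (by norm_num)).const_mul r₀
  obtain ⟨j₀, hj₀⟩ := eventually_atTop.1 (hrlim.eventually_lt_const hd)
  set M : ℝ≥0∞ := 2 ^ (m + 1 + 1) * ENNReal.ofReal (2 ^ (m + 1) * r₀ ^ ((σ - 1) * m)) * κ⁻¹ with hM
  have hMt : M ≠ ⊤ := by rw [hM]; finiteness
  refine exists_tendsto_nhdsGT_zero_of_dyadic hr₀ (j₀ := j₀)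
    (a := fun j => M * (ENNReal.ofReal ((r₀ * (1 / 2) ^ j) ^ (-(σ * m))) *
      ∫⁻ y in D ∩ Metric.ball x (r₀ * (1 / 2) ^ j), ‖g y‖ₑ)) ?_ ?_
  · rw [ENNReal.tsum_mul_left]
    exact ENNReal.mul_ne_top hMt hfin
  intro j hj r hr1 hr2
  set rj := r₀ * (1 / 2 : ℝ) ^ j with hrj
  have hrj0 : 0 < rj := by positivity
  have hrjle : rj ≤ r₀ := mul_le_of_le_one_right hr₀.le (pow_le_one₀ (by norm_num) (by norm_num))
  have hr1' : rj / 2 ≤ r := by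
    refine le_trans (le_of_eq ?_) hr1
    rw [hrj, pow_succ]; ring
  have hr0 : 0 < r := by linarith
  have hsub : Metric.ball x rj ⊆ D := (Metric.ball_subset_ball (hj₀ j hj).le).trans hdD
  refine (h.edist_average_le hD.measurableSet hsub hr0 (Metric.ball_subset_ball hr2)).trans ?_
  rw [inter_eq_right.2 hsub, ← mul_assoc]
  refine mul_le_mul' ?_ le_rfl
  have hreal : rj * (r ^ (m + 1))⁻¹
      ≤ 2 ^ (m + 1) * r₀ ^ ((σ - 1) * m) * rj ^ (-(σ * m)) := by
    calc rj * (r ^ (m + 1))⁻¹ ≤ rj * ((rj / 2) ^ (m + 1))⁻¹ := by gcongr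
      _ = 2 ^ (m + 1) * (rj ^ m)⁻¹ := by
          rw [div_pow, pow_succ rj]; field_simp
      _ = 2 ^ (m + 1) * (rj ^ ((σ - 1) * m) * rj ^ (-(σ * m))) := by
          rw [← Real.rpow_add hrj0, ← Real.rpow_natCast rj, ← Real.rpow_neg hrj0.le]
          congr 2; ring
      _ ≤ 2 ^ (m + 1) * r₀ ^ ((σ - 1) * m) * rj ^ (-(σ * m)) := by
          rw [mul_assoc]
          gcongr
  rw [inv_volume_ball_eq x hr0, ← hκ, hM]
  calc 2 ^ (m + 1 + 1) * ENNReal.ofReal rj * (ENNReal.ofReal ((r ^ (m + 1))⁻¹) * κ⁻¹)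
      = 2 ^ (m + 1 + 1) * ENNReal.ofReal (rj * (r ^ (m + 1))⁻¹) * κ⁻¹ := by
        rw [ENNReal.ofReal_mul hrj0.le]; ring
    _ ≤ 2 ^ (m + 1 + 1) * ENNReal.ofReal
          (2 ^ (m + 1) * r₀ ^ ((σ - 1) * m) * rj ^ (-(σ * m))) * κ⁻¹ := by gcongr
    _ = 2 ^ (m + 1 + 1) * ENNReal.ofReal (2 ^ (m + 1) * r₀ ^ ((σ - 1) * m)) * κ⁻¹ *
          ENNReal.ofReal (rj ^ (-(σ * m))) := by
        rw [ENNReal.ofReal_mul (by positivity)]; ring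

/-- The pointwise estimate of a function by the potential of its gradient in a John domain. -/
theorem exists_edist_preciseRep_le (m : ℕ) {R K d₀ : ℝ} (hR : 1 ≤ R) (hK : 1 ≤ K) :
    ∃ C : ℝ≥0∞, C ≠ ⊤ ∧ ∀ (D : Set (EuclideanSpace ℝ (Fin (m + 1))))
      (u : EuclideanSpace ℝ (Fin (m + 1)) → ℝ)
      (g : EuclideanSpace ℝ (Fin (m + 1)) → EuclideanSpace ℝ (Fin (m + 1)))
      (x x₀ : EuclideanSpace ℝ (Fin (m + 1))) (γ : ℝ → EuclideanSpace ℝ (Fin (m + 1))) (σ : ℝ),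
      IsOpen D → HasWeakGradientOn D u g → x ∈ D → D ⊆ Metric.ball x R → 1 ≤ σ → σ ≤ 2 →
      (∀ t ∈ Icc 0 R, ∀ t' ∈ Icc 0 R, dist (γ t) (γ t') ≤ |t - t'|) → γ 0 = x → γ R = x₀ →
      (∀ t ∈ Icc 0 R, γ t ∈ D ∧ t ^ σ ≤ K * Metric.infDist (γ t) (frontier D)) →
      d₀ = Metric.infDist x₀ (frontier D) →
      edist (preciseRep u x) (⨍ y in Metric.ball x₀ d₀, u y)
        ≤ C * dyadicPotential D g (2 * R ^ 2) (σ * m) x := by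
  set κ := volume (Metric.ball (0 : EuclideanSpace ℝ (Fin (m + 1))) 1) with hκ
  have hκ0 : κ⁻¹ ≠ ⊤ := by
    simpa using (Metric.measure_ball_pos volume (0 : EuclideanSpace ℝ (Fin (m + 1))) one_pos).ne'
  set Λ : ℝ := (8 * K) ^ (m + 1) * (2 * R) ^ (2 * (m + 1)) with hΛ
  have hΛ0 : 0 ≤ Λ := by positivity
  set C₁ : ℝ≥0∞ := 2 ^ (m + 1 + 4) * 5 ^ (m + 1) * ENNReal.ofReal Λ * κ⁻¹ with hC₁
  set C₂ : ℝ≥0∞ := 2 ^ (m + 1 + 1) * ENNReal.ofReal (4 ^ (m + 1) * Λ) * κ⁻¹ with hC₂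
  set C₃ : ℝ≥0∞ := 2 ^ (m + 1 + 1) * ENNReal.ofReal d₀ *
    ENNReal.ofReal ((8 * K) ^ (m + 1) * (2 * R ^ 2) ^ (2 * (m + 1))) * κ⁻¹ with hC₃
  -- `C₁` is for moving along a dyadic piece of the curve, `C₂` for changing the radius between
  -- pieces, `C₃` for reaching `B`. The last 1 keeps the factor nonzero, so that an infinite
  -- potential gives an infinite bound.
  refine ⟨C₁ + (C₁ + C₂) + C₃ + 1, by rw [hC₁, hC₂, hC₃]; finiteness, ?_⟩
  intro D u g x x₀ γ σ hDo h hxD hDR hσ1 hσ2 hγ hγ0 hγR hJ hd₀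
  set P := dyadicPotential D g (2 * R ^ 2) (σ * m) x with hP
  by_cases hPt : P = ⊤
  · rw [hPt, ENNReal.mul_top (by simp)]; exact le_top
  have hDm := hDo.measurableSet
  -- With `r j = 2R * T j` and `T j ^ σ ≤ R * T j`, the tube over times up to `T j` stays in `B(x, r
  -- j)`; see `hρle`.
  set r : ℕ → ℝ := fun j => 2 * R ^ 2 * (1 / 2) ^ j with hr
  set T : ℕ → ℝ := fun j => R * (1 / 2) ^ j with hT
  have hr0 : ∀ j, 0 < r j := fun j => by simp only [hr]; positivity
  have hT0 : ∀ j, 0 < T j := fun j => by simp only [hT]; positivity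
  have hTr : ∀ j, r j / (2 * R) = T j := fun j => by simp only [hr, hT]; field_simp
  have hTR : ∀ j, T j ≤ R := fun j =>
    mul_le_of_le_one_right (by linarith) (pow_le_one₀ (by norm_num) (by norm_num))
  have hTsucc : ∀ j, T (j + 1) = T j / 2 := fun j => by simp only [hT, pow_succ]; ring
  -- For `t ∈ [T j / 2, T j]` one has `T j ^ σ ≤ 4 * t ^ σ`, so `2 * ρ j` is at most the distance of
  -- `γ t` to the frontier.
  set ρ : ℕ → ℝ := fun j => T j ^ σ / (8 * K) with hρ
  have hρ0 : ∀ j, 0 < ρ j := fun j => by have := hT0 j; simp only [hρ]; positivity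
  have hTσ : ∀ j, T j ^ σ ≤ R * T j := by
    intro j
    calc T j ^ σ = T j ^ (σ - 1) * T j := by
          rw [← Real.rpow_add_one (hT0 j).ne', sub_add_cancel]
      _ ≤ R ^ (σ - 1) * T j := by
          exact mul_le_mul_of_nonneg_right
            (Real.rpow_le_rpow (hT0 j).le (hTR j) (by linarith)) (hT0 j).le
      _ ≤ R ^ (1 : ℝ) * T j := by
          exact mul_le_mul_of_nonneg_right
            (Real.rpow_le_rpow_of_exponent_le hR (by linarith)) (hT0 j).le
      _ = R * T j := by rw [Real.rpow_one]
  have hρle : ∀ j, T j + 2 * ρ j ≤ r j := by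
    intro j
    have e1 : 2 * ρ j ≤ T j ^ σ := by
      have := Real.rpow_nonneg (hT0 j).le σ
      simp only [hρ]
      rw [mul_div_assoc', div_le_iff₀ (by positivity)]
      nlinarith
    have e2 : r j = 2 * R * T j := by simp only [hr, hT]; ring
    rw [e2]
    nlinarith [hTσ j, hT0 j]
  have hcoef : ∀ j, ρ j * ((ρ j ^ (m + 1))⁻¹) ≤ Λ * r j ^ (-(σ * m)) := by
    intro j
    have := rpow_div_mul_inv_pow_le (m := m) hR hK hσ2 (hr0 j)
    rw [hTr j] at this
    exact this
  set a : ℕ → ℝ≥0∞ := fun j => ENNReal.ofReal (r j ^ (-(σ * m))) *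
    ∫⁻ y in D ∩ Metric.ball x (r j), ‖g y‖ₑ
  have haj : ∀ j, a j = ENNReal.ofReal (r j ^ (-(σ * m))) *
    ∫⁻ y in D ∩ Metric.ball x (r j), ‖g y‖ₑ := fun _ => rfl
  have hPa : P = ∑' j, a j := rfl
  have hdistx : ∀ t ∈ Icc 0 R, dist (γ t) x ≤ t := by
    intro t ht
    have := hγ t ht 0 ⟨le_rfl, by linarith⟩
    rwa [hγ0, sub_zero, abs_of_nonneg ht.1] at this
  have hblock : ∀ j t₁ t₂, 0 ≤ t₁ → t₁ ≤ t₂ → t₂ ≤ T j →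
      (∀ t ∈ Icc t₁ t₂, Metric.ball (γ t) (2 * ρ j) ⊆ D) →
      edist (⨍ y in Metric.ball (γ t₁) (ρ j), u y) (⨍ y in Metric.ball (γ t₂) (ρ j), u y)
        ≤ C₁ * a j := by
    intro j t₁ t₂ h0 h12 h2 hball
    have hsubR : Icc t₁ t₂ ⊆ Icc 0 R := Icc_subset_Icc h0 (h2.trans (hTR j))
    refine (h.edist_average_curve_le hDm (U := D ∩ Metric.ball x (r j)) h12 (hρ0 j)
      (fun s hs t ht => hγ s (hsubR hs) t (hsubR ht)) inter_subset_left
      (fun t ht => subset_inter (hball t ht) ?_)).trans ?_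
    · refine Metric.ball_subset_ball' ?_
      linarith [hdistx t (hsubR ht), ht.2, hρle j]
    · rw [inv_volume_ball_eq _ (hρ0 j), ← hκ, haj, ← mul_assoc C₁, hC₁]
      refine mul_le_mul' ?_ le_rfl
      calc 2 ^ (m + 1 + 4) * 5 ^ (m + 1) * ENNReal.ofReal (ρ j) *
            (ENNReal.ofReal ((ρ j ^ (m + 1))⁻¹) * κ⁻¹)
          = 2 ^ (m + 1 + 4) * 5 ^ (m + 1) * ENNReal.ofReal (ρ j * (ρ j ^ (m + 1))⁻¹) * κ⁻¹ := by
            rw [ENNReal.ofReal_mul (hρ0 j).le]; ring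
        _ ≤ 2 ^ (m + 1 + 4) * 5 ^ (m + 1) * ENNReal.ofReal (Λ * r j ^ (-(σ * m))) * κ⁻¹ := by
            have := hcoef j
            gcongr
        _ = _ := by rw [ENNReal.ofReal_mul hΛ0]; ring
  have htube : ∀ j, ∀ t ∈ Icc (T (j + 1)) (T j), Metric.ball (γ t) (2 * ρ j) ⊆ D := by
    intro j t ht
    have ht0 : t ∈ Icc 0 R := ⟨(hT0 _).le.trans ht.1, ht.2.trans (hTR j)⟩
    obtain ⟨htD, htJ⟩ := hJ t ht0
    refine (Metric.ball_subset_ball ?_).trans (ball_infDist_frontier_subset hDo htD)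
    have e1 : T j ^ σ ≤ 4 * t ^ σ := by
      have : T j ≤ 2 * t := by have := ht.1; rw [hTsucc] at this; linarith
      calc T j ^ σ ≤ (2 * t) ^ σ := Real.rpow_le_rpow (hT0 j).le this (by linarith)
        _ = 2 ^ σ * t ^ σ := Real.mul_rpow (by norm_num) ht0.1
        _ ≤ 2 ^ (2 : ℝ) * t ^ σ := by
            have := Real.rpow_nonneg ht0.1 σ
            gcongr
            norm_num
        _ = 4 * t ^ σ := by norm_num
    have e2 : 2 * ρ j = T j ^ σ / (4 * K) := by simp only [hρ]; field_simp; ring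
    rw [e2, div_le_iff₀ (by positivity)]
    linarith
  set V : ℕ → ℝ := fun j => ⨍ y in Metric.ball (γ (T j)) (ρ j), u y with hV
  have hstep : ∀ j, edist (V j) (V (j + 1)) ≤ (C₁ + C₂) * a j := by
    intro j
    have hTle : T (j + 1) ≤ T j := by rw [hTsucc]; linarith [hT0 j]
    have e1 := hblock j (T (j + 1)) (T j) (hT0 _).le hTle le_rfl (htube j)
    have hρs : ρ j / 4 ≤ ρ (j + 1) := by
      simp only [hρ, hTsucc]
      rw [Real.div_rpow (hT0 j).le (by norm_num), div_right_comm]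
      have := Real.rpow_nonneg (hT0 j).le σ
      gcongr
      calc (2 : ℝ) ^ σ ≤ 2 ^ (2 : ℝ) := by gcongr; norm_num
        _ = 4 := by norm_num
    have hρle' : ρ (j + 1) ≤ ρ j := by
      simp only [hρ]
      have := (hT0 (j + 1)).le
      gcongr
    have hbb : Metric.ball (γ (T (j + 1))) (ρ j) ⊆ D ∩ Metric.ball x (r j) := by
      refine subset_inter ((Metric.ball_subset_ball ?_).trans
        (htube j _ (left_mem_Icc.2 hTle))) (Metric.ball_subset_ball' ?_)
      · linarith [hρ0 j]
      · linarith [hdistx (T (j + 1)) ⟨(hT0 _).le, hTR _⟩, hρ0 j, hρle j]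
    have e2 := h.edist_average_le hDm (p := γ (T (j + 1))) (q := γ (T (j + 1)))
      (hbb.trans inter_subset_left) (hρ0 (j + 1)) (Metric.ball_subset_ball hρle')
    have e3 : 2 ^ (m + 1 + 1) * ENNReal.ofReal (ρ j) *
        (volume (Metric.ball (γ (T (j + 1))) (ρ (j + 1))))⁻¹ *
        ∫⁻ y in Metric.ball (γ (T (j + 1))) (ρ j), ‖g y‖ₑ ≤ C₂ * a j := by
      rw [inv_volume_ball_eq _ (hρ0 (j + 1)), ← hκ, haj, ← mul_assoc C₂, hC₂]
      refine mul_le_mul' ?_ (lintegral_mono_set hbb)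
      have hreal : ρ j * (ρ (j + 1) ^ (m + 1))⁻¹ ≤ 4 ^ (m + 1) * Λ * r j ^ (-(σ * m)) := by
        have := hρ0 j
        calc ρ j * (ρ (j + 1) ^ (m + 1))⁻¹ ≤ ρ j * ((ρ j / 4) ^ (m + 1))⁻¹ := by gcongr
          _ = 4 ^ (m + 1) * (ρ j * (ρ j ^ (m + 1))⁻¹) := by
              rw [div_pow]; field_simp
          _ ≤ 4 ^ (m + 1) * (Λ * r j ^ (-(σ * m))) := by
              exact mul_le_mul_of_nonneg_left (hcoef j) (by positivity)
          _ = _ := by ring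
      calc 2 ^ (m + 1 + 1) * ENNReal.ofReal (ρ j) *
            (ENNReal.ofReal ((ρ (j + 1) ^ (m + 1))⁻¹) * κ⁻¹)
          = 2 ^ (m + 1 + 1) * ENNReal.ofReal (ρ j * (ρ (j + 1) ^ (m + 1))⁻¹) * κ⁻¹ := by
            rw [ENNReal.ofReal_mul (hρ0 j).le]; ring
        _ ≤ 2 ^ (m + 1 + 1) * ENNReal.ofReal (4 ^ (m + 1) * Λ * r j ^ (-(σ * m))) * κ⁻¹ := by
            gcongr
        _ = _ := by rw [ENNReal.ofReal_mul (by positivity)]; ring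
    calc edist (V j) (V (j + 1))
        ≤ edist (V j) (⨍ y in Metric.ball (γ (T (j + 1))) (ρ j), u y)
          + edist (⨍ y in Metric.ball (γ (T (j + 1))) (ρ j), u y) (V (j + 1)) :=
          edist_triangle _ _ _
      _ ≤ C₁ * a j + C₂ * a j := by
          refine add_le_add ?_ (e2.trans e3)
          rw [edist_comm]
          exact e1
      _ = (C₁ + C₂) * a j := by ring
  have htop : edist (V 0) (⨍ y in Metric.ball x₀ d₀, u y) ≤ C₃ * a 0 := by
    have hT00 : T 0 = R := by simp [hT]
    have hx₀D : x₀ ∈ D := by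
      have := (hJ R ⟨by linarith, le_rfl⟩).1
      rwa [hγR] at this
    have hbD : Metric.ball x₀ d₀ ⊆ D := by
      rw [hd₀]; exact ball_infDist_frontier_subset hDo hx₀D
    have hRσ : 1 ≤ R ^ σ := Real.one_le_rpow hR (by linarith)
    have hρd : ρ 0 ≤ d₀ := by
      have := (hJ R ⟨by linarith, le_rfl⟩).2
      rw [hγR, ← hd₀] at this
      simp only [hρ, hT00]
      rw [div_le_iff₀ (by positivity)]
      have h0 : 0 ≤ K * d₀ := by linarith
      linarith
    have e2 := h.edist_average_le hDm (p := x₀) (q := x₀) hbD (hρ0 0)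
      (Metric.ball_subset_ball hρd)
    have hV0 : V 0 = ⨍ y in Metric.ball x₀ (ρ 0), u y := by simp only [hV, hT00, hγR]
    rw [hV0, edist_comm]
    refine e2.trans ?_
    have hr00 : r 0 = 2 * R ^ 2 := by simp [hr]
    rw [inv_volume_ball_eq _ (hρ0 0), ← hκ, haj, ← mul_assoc C₃, hC₃]
    refine mul_le_mul' ?_ (lintegral_mono_set (subset_inter hbD (hbD.trans (hDR.trans
      (Metric.ball_subset_ball ?_)))))
    · have hreal : (ρ 0 ^ (m + 1))⁻¹
          ≤ (8 * K) ^ (m + 1) * (2 * R ^ 2) ^ (2 * (m + 1)) * r 0 ^ (-(σ * m)) := by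
        have h1 : 1 / (8 * K) ≤ ρ 0 := by
          simp only [hρ, hT00]
          gcongr
        have h2 : 1 ≤ (2 * R ^ 2) ^ (2 * (m + 1)) * r 0 ^ (-(σ * m)) := by
          rw [hr00, ← Real.rpow_natCast, ← Real.rpow_add (by positivity)]
          refine Real.one_le_rpow (by nlinarith) ?_
          push_cast
          nlinarith [Nat.cast_nonneg (α := ℝ) m]
        calc (ρ 0 ^ (m + 1))⁻¹ ≤ ((1 / (8 * K)) ^ (m + 1))⁻¹ := by gcongr
          _ = (8 * K) ^ (m + 1) * 1 := by rw [div_pow, one_pow]; field_simp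
          _ ≤ (8 * K) ^ (m + 1) * ((2 * R ^ 2) ^ (2 * (m + 1)) * r 0 ^ (-(σ * m))) := by gcongr
          _ = _ := by ring
      calc 2 ^ (m + 1 + 1) * ENNReal.ofReal d₀ * (ENNReal.ofReal ((ρ 0 ^ (m + 1))⁻¹) * κ⁻¹)
          ≤ 2 ^ (m + 1 + 1) * ENNReal.ofReal d₀ * (ENNReal.ofReal
            ((8 * K) ^ (m + 1) * (2 * R ^ 2) ^ (2 * (m + 1)) * r 0 ^ (-(σ * m))) * κ⁻¹) := by
            gcongr
        _ = _ := by rw [ENNReal.ofReal_mul (by positivity)]; ring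
    · rw [hr00]; nlinarith
  have hTlim : Tendsto T atTop (𝓝 0) := by
    simpa [hT] using (tendsto_pow_atTop_nhds_zero_of_lt_one (r := (1 / 2 : ℝ)) (by norm_num)
      (by norm_num)).const_mul R
  have hρlim : Tendsto ρ atTop (𝓝 0) := by
    have h1 : Tendsto (fun j => R * T j) atTop (𝓝 0) := by simpa using hTlim.const_mul R
    refine squeeze_zero (fun j => (hρ0 j).le) (fun j => ?_) h1
    refine le_trans ?_ (hTσ j)
    exact div_le_self (Real.rpow_nonneg (hT0 j).le _) (by linarith)
  obtain ⟨d, hd, hdD⟩ := Metric.isOpen_iff.1 hDo x hxD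
  -- The John condition degenerates as `t → 0`. For large `J` the whole tube over `[0, T J]` lies in
  -- a ball about `x` inside `D`, which settles the last stretch.
  have hev : ∀ᶠ J in atTop, T J + 2 * ρ J < d := by
    have : Tendsto (fun J => T J + 2 * ρ J) atTop (𝓝 0) := by
      simpa using hTlim.add (hρlim.const_mul 2)
    exact this.eventually_lt_const hd
  have haP : ∀ j, a j ≤ P := fun j => hPa ▸ ENNReal.le_tsum j
  have hbound : ∀ᶠ J in atTop, edist (⨍ y in Metric.ball x (ρ J), u y)
      (⨍ y in Metric.ball x₀ d₀, u y) ≤ (C₁ + (C₁ + C₂) + C₃ + 1) * P := by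
    filter_upwards [hev] with J hJd
    have e1 : edist (⨍ y in Metric.ball x (ρ J), u y) (V J) ≤ C₁ * a J := by
      have := hblock J 0 (T J) le_rfl (hT0 J).le le_rfl fun t ht =>
        (Metric.ball_subset_ball' (by
          linarith [hdistx t ⟨ht.1, ht.2.trans (hTR J)⟩, ht.2])).trans hdD
      rwa [hγ0] at this
    have e2 : edist (V 0) (V J) ≤ (C₁ + C₂) * P := by
      refine (edist_le_range_sum_edist V J).trans ?_
      refine (Finset.sum_le_sum fun j _ => hstep j).trans ?_
      rw [← Finset.mul_sum, hPa]
      gcongr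
      exact ENNReal.sum_le_tsum _
    rw [edist_comm] at e2
    calc edist (⨍ y in Metric.ball x (ρ J), u y) (⨍ y in Metric.ball x₀ d₀, u y)
        ≤ edist (⨍ y in Metric.ball x (ρ J), u y) (V J) + edist (V J) (V 0)
          + edist (V 0) (⨍ y in Metric.ball x₀ d₀, u y) := edist_triangle4 _ _ _ _
      _ ≤ C₁ * P + (C₁ + C₂) * P + C₃ * P := by
          refine add_le_add (add_le_add (e1.trans ?_) e2) (htop.trans ?_)
          · exact mul_le_mul' le_rfl (haP J)
          · exact mul_le_mul' le_rfl (haP 0)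
      _ = (C₁ + (C₁ + C₂) + C₃) * P := by ring
      _ ≤ (C₁ + (C₁ + C₂) + C₃ + 1) * P := mul_le_mul' le_self_add le_rfl
  have hlim := tendsto_preciseRep (exists_tendsto_average_of_dyadicPotential_ne_top h hDo hxD
    (by positivity) hσ1 hPt)
  have hρlim' : Tendsto ρ atTop (𝓝[>] 0) :=
    tendsto_nhdsWithin_iff.2 ⟨hρlim, Eventually.of_forall hρ0⟩
  exact le_of_tendsto ((hlim.comp hρlim').edist tendsto_const_nhds) hbound

/-! ### Bounding the potential: Young's inequality and log-Hölder continuity -/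

/-- Young's inequality with a parameter, for exponents bounded away from one. -/
theorem mul_le_of_young {f G t p p' q : ℝ} (hf : 0 ≤ f) (hG : 0 ≤ G) (ht : 1 ≤ t)
    (hpp : p.HolderConjugate p') (hq : q ≤ p') :
    f * G ≤ t * f ^ p + t ^ (1 - q) * G ^ p' := by
  have ht0 : 0 < t := by linarith
  -- Young for `f` and `G / t`, multiplied by `t`; then `t ^ (1 - p') ≤ t ^ (1 - q)` because `t ≥
  -- 1`.
  have h1 := Real.young_inequality_of_nonneg hf (div_nonneg hG ht0.le) hpp
  have h2 : f ^ p / p ≤ f ^ p := div_le_self (by positivity) hpp.lt.le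
  have h3 : (G / t) ^ p' / p' ≤ (G / t) ^ p' := div_le_self (by positivity) hpp.symm.lt.le
  have h4 : t * (G / t) ^ p' ≤ t ^ (1 - q) * G ^ p' := by
    rw [Real.div_rpow hG ht0.le, mul_div_assoc', mul_comm t, mul_div_assoc, mul_comm]
    gcongr
    rw [div_le_iff₀ (by positivity), ← Real.rpow_add ht0]
    calc t = t ^ (1 : ℝ) := (Real.rpow_one t).symm
      _ ≤ t ^ (1 - q + p') := Real.rpow_le_rpow_of_exponent_le ht (by linarith)
  calc f * G = t * (f * (G / t)) := by field_simp
    _ ≤ t * (f ^ p + (G / t) ^ p') := by gcongr; linarith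
    _ ≤ _ := by rw [mul_add]; linarith

/-- The logarithmic modulus of continuity cancels `-log r`, which is at most `log (e + 1 / r)`. -/
theorem rpow_neg_div_log_le {r c : ℝ} (hr : 0 < r) (hr1 : r < 1) (hc : 0 ≤ c) :
    r ^ (-(c / Real.log (Real.exp 1 + 1 / r))) ≤ Real.exp c := by
  have h1 : 0 < 1 / r := by positivity
  have hlog : 1 ≤ Real.log (Real.exp 1 + 1 / r) := by
    rw [Real.le_log_iff_exp_le (by positivity)]
    linarith
  have h2 : -Real.log r ≤ Real.log (Real.exp 1 + 1 / r) := by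
    rw [← Real.log_inv, ← one_div]
    exact Real.log_le_log h1 (by linarith [Real.exp_pos 1])
  rw [Real.rpow_def_of_pos hr]
  refine Real.exp_le_exp.2 ?_
  rw [mul_neg, ← neg_mul, mul_div_assoc', div_le_iff₀ (by linarith), mul_comm]
  gcongr

/-- Log-Hölder continuity allows to replace the ratio of exponents by one. -/
theorem rpow_neg_mul_div_le {N r r₀ c a b d : ℝ} (hN : 0 ≤ N) (hr : 0 < r) (hrr : r ≤ r₀)
    (hr₀ : 1 ≤ r₀) (hc : 0 ≤ c) (ha : 1 ≤ a) (hb : 1 ≤ b) (hdr : d < r)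
    (hab : a = b ∨ 0 < d ∧ |a - b| ≤ c / Real.log (Real.exp 1 + 1 / d)) :
    r ^ (-(N * (a / b))) ≤ Real.exp (N * c) * r₀ ^ N * r ^ (-N) := by
  have hE : 1 ≤ Real.exp (N * c) := Real.one_le_exp (by positivity)
  have hr₀N : 1 ≤ r₀ ^ N := Real.one_le_rpow hr₀ hN
  rcases le_or_gt 1 r with h1 | h1
  · calc r ^ (-(N * (a / b))) ≤ 1 := Real.rpow_le_one_of_one_le_of_nonpos h1 (by
          have : 0 ≤ N * (a / b) := by positivity
          linarith)
      _ = r ^ N * r ^ (-N) := by rw [← Real.rpow_add hr]; simp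
      _ ≤ r₀ ^ N * r ^ (-N) := by gcongr
      _ ≤ Real.exp (N * c) * r₀ ^ N * r ^ (-N) := by
          rw [mul_assoc]
          exact le_mul_of_one_le_left (by positivity) hE
  · have hl : 0 < Real.log (Real.exp 1 + 1 / r) := by
      refine Real.log_pos ?_
      have : (0 : ℝ) < 1 / r := by positivity
      linarith [Real.add_one_lt_exp (one_ne_zero)]
    -- The modulus increases with the distance, so it may be taken at `r > d`; dividing by `b ≥ 1`
    -- loses nothing.
    have hδ : a / b - 1 ≤ c / Real.log (Real.exp 1 + 1 / r) := by
      rcases hab with hab | ⟨hd0, hab⟩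
      · rw [hab, div_self (by linarith), sub_self]; positivity
      · calc a / b - 1 = (a - b) / b := by field_simp
          _ ≤ |a - b| / b := by gcongr; exact le_abs_self _
          _ ≤ |a - b| := div_le_self (abs_nonneg _) hb
          _ ≤ c / Real.log (Real.exp 1 + 1 / d) := hab
          _ ≤ c / Real.log (Real.exp 1 + 1 / r) := by gcongr
    calc r ^ (-(N * (a / b)))
        ≤ r ^ (-(N * c / Real.log (Real.exp 1 + 1 / r)) + -N) := by
          refine Real.rpow_le_rpow_of_exponent_ge hr h1.le ?_
          have := mul_le_mul_of_nonneg_left hδ hN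
          rw [mul_div_assoc']  at this
          linarith
      _ = r ^ (-(N * c / Real.log (Real.exp 1 + 1 / r))) * r ^ (-N) := Real.rpow_add hr _ _
      _ ≤ (Real.exp (N * c) * 1) * r ^ (-N) := by
          rw [mul_one]
          gcongr
          exact rpow_neg_div_log_le hr h1 (by positivity)
      _ ≤ Real.exp (N * c) * r₀ ^ N * r ^ (-N) := by gcongr

section Potential

variable {m : ℕ} {D : Set (EuclideanSpace ℝ (Fin (m + 1)))}
  {s p : EuclideanSpace ℝ (Fin (m + 1)) → ℝ}
  {g : EuclideanSpace ℝ (Fin (m + 1)) → EuclideanSpace ℝ (Fin (m + 1))}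
  {r₀ c S : ℝ}

/-- The contribution of a subset of a ball to the potential, in terms of the modular of the
gradient. -/
theorem ofReal_rpow_mul_lintegral_le (hm : 1 ≤ m) (hr₀ : 1 ≤ r₀) (hc : 0 ≤ c)
    (hSm : S * m < m + 1) (hs1 : ∀ y ∈ D, 1 ≤ s y) (hsS : ∀ y ∈ D, s y ≤ S)
    (hp : ∀ y ∈ D, p y = (m + 1) / ((m + 1) - s y * m))
    (hlog : ∀ x ∈ D, ∀ y ∈ D, x ≠ y → |s x - s y| ≤ c / Real.log (Real.exp 1 + 1 / dist x y))
    {x : EuclideanSpace ℝ (Fin (m + 1))} (hx : x ∈ D) {r t : ℝ} (hr : 0 < r) (hrr : r ≤ r₀)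
    (ht : 1 ≤ t) {A : Set (EuclideanSpace ℝ (Fin (m + 1)))} (hA : MeasurableSet A) (hAD : A ⊆ D)
    (hAr : A ⊆ Metric.ball x r) :
    ENNReal.ofReal (r ^ (-(s x * m))) * ∫⁻ y in A, ‖g y‖ₑ
      ≤ ENNReal.ofReal t * (∫⁻ y in A, ENNReal.ofReal (‖g y‖ ^ p y))
        + ENNReal.ofReal (t ^ (1 - (m + 1) / (S * m))) *
          (ENNReal.ofReal (Real.exp ((m + 1) * c) * r₀ ^ ((m : ℝ) + 1)) *
            volume (Metric.ball (0 : EuclideanSpace ℝ (Fin (m + 1))) 1)) := by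
  have hm0 : (0 : ℝ) < m := by exact_mod_cast hm
  set q : ℝ := (m + 1) / (S * m) with hq
  set C := Real.exp ((m + 1) * c) * r₀ ^ ((m : ℝ) + 1) with hC
  set G := r ^ (-(s x * m)) with hG
  have hG0 : 0 ≤ G := by positivity
  have hpt : ∀ y ∈ A, ENNReal.ofReal G * ‖g y‖ₑ ≤ ENNReal.ofReal t * ENNReal.ofReal (‖g y‖ ^ p y)
      + ENNReal.ofReal (t ^ (1 - q) * (C * r ^ (-((m : ℝ) + 1)))) := by
    intro y hy
    have hyD := hAD hy
    have h1 := hs1 y hyD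
    have hsy : s y * m < m + 1 := lt_of_le_of_lt (by gcongr; exact hsS y hyD) hSm
    have hsm : 0 < s y * m := by positivity
    set p' : ℝ := (m + 1) / (s y * m) with hp'
    have hpp : (p y).HolderConjugate p' := by
      rw [Real.holderConjugate_iff, hp y hyD, hp']
      refine ⟨?_, ?_⟩
      · rw [one_lt_div (by linarith)]; linarith
      · rw [inv_div, inv_div]; field_simp; ring
    have hqp : q ≤ p' := by
      rw [hq, hp']
      gcongr
      exact hsS y hyD
    have hY := mul_le_of_young (norm_nonneg (g y)) hG0 ht hpp hqp
    -- The power is exactly `r ^ (-(m + 1) * (s x / s y))`. Replacing the ratio by 1 gives the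
    -- reciprocal of the volume of the ball, up to a constant.
    have hGp : G ^ p' ≤ C * r ^ (-((m : ℝ) + 1)) := by
      rw [hG, ← Real.rpow_mul hr.le, hp']
      have e : -(s x * m) * ((m + 1) / (s y * m)) = -((m + 1 : ℝ) * (s x / s y)) := by field_simp
      rw [e]
      have hdist : dist x y < r := Metric.mem_ball'.1 (hAr hy)
      refine rpow_neg_mul_div_le (d := dist x y) (by positivity) hr hrr hr₀ hc (hs1 x hx) h1
        hdist ?_
      by_cases hxy : x = y
      · exact Or.inl (by rw [hxy])
      · exact Or.inr ⟨dist_pos.2 hxy, hlog x hx y hyD hxy⟩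
    rw [← ofReal_norm, ← ENNReal.ofReal_mul hG0, ← ENNReal.ofReal_mul (by linarith),
      ← ENNReal.ofReal_add (by positivity) (by positivity)]
    refine ENNReal.ofReal_le_ofReal ?_
    rw [mul_comm]
    refine hY.trans ?_
    gcongr
  calc ENNReal.ofReal G * ∫⁻ y in A, ‖g y‖ₑ = ∫⁻ y in A, ENNReal.ofReal G * ‖g y‖ₑ :=
        (lintegral_const_mul' _ _ ENNReal.ofReal_ne_top).symm
    _ ≤ ∫⁻ y in A, (ENNReal.ofReal t * ENNReal.ofReal (‖g y‖ ^ p y)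
          + ENNReal.ofReal (t ^ (1 - q) * (C * r ^ (-((m : ℝ) + 1))))) :=
        setLIntegral_mono' hA hpt
    _ = ENNReal.ofReal t * (∫⁻ y in A, ENNReal.ofReal (‖g y‖ ^ p y))
          + ENNReal.ofReal (t ^ (1 - q) * (C * r ^ (-((m : ℝ) + 1)))) * volume A := by
        rw [lintegral_add_right _ measurable_const, lintegral_const,
          lintegral_const_mul' _ _ ENNReal.ofReal_ne_top, Measure.restrict_apply_univ]
    _ ≤ ENNReal.ofReal t * (∫⁻ y in A, ENNReal.ofReal (‖g y‖ ^ p y))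
          + ENNReal.ofReal (t ^ (1 - q) * (C * r ^ (-((m : ℝ) + 1)))) *
            volume (Metric.ball x r) := by gcongr
    _ = _ := by
        congr 1
        rw [Measure.addHaar_ball_of_pos volume x hr, finrank_euclideanSpace_fin, ← mul_assoc,
          ← ENNReal.ofReal_mul (by positivity), ← mul_assoc (ENNReal.ofReal (t ^ (1 - q))),
          ← ENNReal.ofReal_mul (by positivity)]
        congr 2
        have : r ^ (-((m : ℝ) + 1)) * r ^ (m + 1) = 1 := by
          rw [← Real.rpow_natCast, ← Real.rpow_add hr]
          push_cast
          rw [neg_add_cancel, Real.rpow_zero]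
        rw [mul_assoc, mul_assoc C, this, mul_one]

/-- The dyadic annuli around a point of a set. -/
def dyadicAnnulus {E : Type*} [PseudoMetricSpace E] (D : Set E) (r₀ : ℝ) (x : E) (i : ℕ) : Set E :=
  D ∩ (Metric.ball x (r₀ * (1 / 2) ^ i) \ Metric.ball x (r₀ * (1 / 2) ^ (i + 1)))

theorem measurableSet_dyadicAnnulus {E : Type*} [PseudoMetricSpace E] [MeasurableSpace E]
    [OpensMeasurableSpace E] {D : Set E} (hD : MeasurableSet D) (r₀ : ℝ) (x : E) (i : ℕ) :
    MeasurableSet (dyadicAnnulus D r₀ x i) :=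
  hD.inter (measurableSet_ball.diff measurableSet_ball)

theorem pairwise_disjoint_dyadicAnnulus {E : Type*} [PseudoMetricSpace E] (D : Set E) {r₀ : ℝ}
    (hr₀ : 0 ≤ r₀) (x : E) : Pairwise (Function.onFun Disjoint (dyadicAnnulus D r₀ x)) := by
  have key : ∀ i j, i < j → Disjoint (dyadicAnnulus D r₀ x i) (dyadicAnnulus D r₀ x j) := by
    intro i j hij
    rw [Set.disjoint_left]
    rintro y ⟨-, -, hy⟩ ⟨-, hy', -⟩
    refine hy (Metric.ball_subset_ball ?_ hy')
    gcongr r₀ * ?_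
    exact pow_le_pow_of_le_one (by norm_num) (by norm_num) hij
  intro i j hij
  rcases lt_or_gt_of_ne hij with h | h
  · exact key i j h
  · exact (key j i h).symm

theorem inter_ball_subset_iUnion_dyadicAnnulus {E : Type*} [MetricSpace E] (D : Set E)
    (r₀ : ℝ) (x : E) (j : ℕ) :
    D ∩ Metric.ball x (r₀ * (1 / 2) ^ j) ⊆ {x} ∪ ⋃ k, dyadicAnnulus D r₀ x (j + k) := by
  classical
  rintro y ⟨hyD, hy⟩
  by_cases hyx : y = x
  · exact Or.inl hyx
  right
  have hex : ∃ k, y ∉ Metric.ball x (r₀ * (1 / 2) ^ (j + k)) := by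
    have hlim : Tendsto (fun k : ℕ => r₀ * (1 / 2 : ℝ) ^ (j + k)) atTop (𝓝 0) := by
      have h1 := (tendsto_pow_atTop_nhds_zero_of_lt_one (r := (1 / 2 : ℝ)) (by norm_num)
        (by norm_num)).const_mul (r₀ * (1 / 2 : ℝ) ^ j)
      rw [mul_zero] at h1
      refine h1.congr fun k => ?_
      rw [pow_add]; ring
    obtain ⟨k, hk⟩ := (hlim.eventually_lt_const (dist_pos.2 hyx)).exists
    exact ⟨k, fun h => absurd (Metric.mem_ball.1 h) (by linarith)⟩
  have hk := Nat.find_spec hex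
  have hk0 : Nat.find hex ≠ 0 := by
    intro h0
    rw [h0] at hk
    exact hk hy
  obtain ⟨l, hl⟩ := Nat.exists_eq_succ_of_ne_zero hk0
  refine mem_iUnion.2 ⟨l, hyD, ?_, ?_⟩
  · by_contra hcon
    exact Nat.find_min hex (by omega) hcon
  · rw [hl] at hk
    exact hk

/-- Split each ball into annuli and exchange the sums: since `β ≥ 1`, the weight of ball `j` is at
most `2⁻ᵏ` times that of annulus `j + k`, and the geometric series sums to 2. -/
theorem dyadicPotential_le_tsum_annulus (hr₀ : 0 < r₀) {β : ℝ} (hβ : 1 ≤ β)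
    (x : EuclideanSpace ℝ (Fin (m + 1))) :
    dyadicPotential D g r₀ β x ≤ 2 * ∑' i : ℕ, ENNReal.ofReal ((r₀ * (1 / 2) ^ i) ^ (-β)) *
      ∫⁻ y in dyadicAnnulus D r₀ x i, ‖g y‖ₑ := by
  set F : ℕ → ℝ≥0∞ := fun i => ENNReal.ofReal ((r₀ * (1 / 2) ^ i) ^ (-β)) *
      ∫⁻ y in dyadicAnnulus D r₀ x i, ‖g y‖ₑ with hF
  have hcoef : ∀ j k : ℕ, ENNReal.ofReal ((r₀ * (1 / 2) ^ j) ^ (-β))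
      ≤ (1 / 2) ^ k * ENNReal.ofReal ((r₀ * (1 / 2) ^ (j + k)) ^ (-β)) := by
    intro j k
    have e : (1 / 2 : ℝ≥0∞) ^ k = ENNReal.ofReal ((1 / 2) ^ k) := by
      rw [ENNReal.ofReal_pow (by norm_num), ENNReal.ofReal_div_of_pos (by norm_num)]; simp
    rw [e, ← ENNReal.ofReal_mul (by positivity)]
    refine ENNReal.ofReal_le_ofReal ?_
    have hk : (0 : ℝ) < (1 / 2) ^ k := by positivity
    rw [pow_add, ← mul_assoc, Real.mul_rpow (x := r₀ * (1 / 2) ^ j) (by positivity) hk.le,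
      mul_left_comm]
    refine le_mul_of_one_le_right (by positivity) ?_
    nth_rewrite 1 [← Real.rpow_one ((1 / 2 : ℝ) ^ k)]
    rw [← Real.rpow_add hk]
    exact Real.one_le_rpow_of_pos_of_le_one_of_nonpos hk
      (pow_le_one₀ (by norm_num) (by norm_num)) (by linarith)
  calc dyadicPotential D g r₀ β x
      ≤ ∑' j : ℕ, ∑' k : ℕ, (1 / 2) ^ k * F (j + k) := by
        refine ENNReal.tsum_le_tsum fun j => ?_
        calc ENNReal.ofReal ((r₀ * (1 / 2) ^ j) ^ (-β)) *
              ∫⁻ y in D ∩ Metric.ball x (r₀ * (1 / 2) ^ j), ‖g y‖ₑ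
            ≤ ENNReal.ofReal ((r₀ * (1 / 2) ^ j) ^ (-β)) *
              ∑' k, ∫⁻ y in dyadicAnnulus D r₀ x (j + k), ‖g y‖ₑ := by
              refine mul_le_mul' le_rfl ?_
              refine (lintegral_mono_set
                (inter_ball_subset_iUnion_dyadicAnnulus D r₀ x j)).trans ?_
              refine (lintegral_union_le _ _ _).trans ?_
              rw [setLIntegral_measure_zero _ _ (measure_singleton x), zero_add]
              exact lintegral_iUnion_le _ _
          _ ≤ ∑' k : ℕ, (1 / 2) ^ k * F (j + k) := by
              rw [← ENNReal.tsum_mul_left]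
              refine ENNReal.tsum_le_tsum fun k => ?_
              simp only [hF]
              rw [← mul_assoc]
              exact mul_le_mul' (hcoef j k) le_rfl
    _ = ∑' k : ℕ, (1 / 2) ^ k * ∑' j : ℕ, F (j + k) := by
        rw [ENNReal.tsum_comm]
        exact tsum_congr fun k => ENNReal.tsum_mul_left
    _ ≤ ∑' k : ℕ, (1 / 2) ^ k * ∑' i : ℕ, F i := by
        refine ENNReal.tsum_le_tsum fun k => mul_le_mul' le_rfl ?_
        exact ENNReal.tsum_comp_le_tsum_of_injective (add_left_injective k) F
    _ = 2 * ∑' i : ℕ, F i := by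
        rw [ENNReal.tsum_mul_right, ENNReal.tsum_geometric, one_div, ENNReal.one_sub_inv_two,
          inv_inv]

end Potential

/-- Logarithmic growth of the potential off the set where the modular is concentrated. -/
theorem exists_dyadicPotential_le {m : ℕ} {r₀ c S : ℝ} {W₀ : ℝ≥0∞} (hm : 1 ≤ m) (hr₀ : 1 ≤ r₀)
    (hc : 0 ≤ c) (hS1 : 1 ≤ S) (hSm : S * m < m + 1) (hW₀ : W₀ ≠ ⊤) :
    ∃ C : ℝ≥0∞, C ≠ ⊤ ∧ ∀ (D : Set (EuclideanSpace ℝ (Fin (m + 1))))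
      (s p : EuclideanSpace ℝ (Fin (m + 1)) → ℝ)
      (g : EuclideanSpace ℝ (Fin (m + 1)) → EuclideanSpace ℝ (Fin (m + 1)))
      (x : EuclideanSpace ℝ (Fin (m + 1))) (M : ℕ),
      MeasurableSet D → (∀ y ∈ D, 1 ≤ s y) → (∀ y ∈ D, s y ≤ S) →
      (∀ y ∈ D, p y = (m + 1) / ((m + 1) - s y * m)) →
      (∀ x ∈ D, ∀ y ∈ D, x ≠ y → |s x - s y| ≤ c / Real.log (Real.exp 1 + 1 / dist x y)) →
      ∫⁻ y in D, ENNReal.ofReal (‖g y‖ ^ p y) ≤ W₀ → x ∈ D → 1 ≤ M →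
      (∀ k : ℕ, ∫⁻ y in D ∩ Metric.ball x (r₀ * (1 / 2) ^ (M + k)), ENNReal.ofReal (‖g y‖ ^ p y)
        ≤ (1 / 2) ^ k) →
      dyadicPotential D g r₀ (s x * m) x
        ≤ C * ENNReal.ofReal ((M : ℝ) ^ (1 / ((m + 1) / (S * m)) : ℝ)) := by
  have hm0 : (0 : ℝ) < m := by exact_mod_cast hm
  set q : ℝ := (m + 1) / (S * m) with hq
  have hq1 : 1 < q := by rw [hq, one_lt_div (by positivity)]; exact hSm
  set C₃ : ℝ≥0∞ := ENNReal.ofReal (Real.exp ((m + 1) * c) * r₀ ^ ((m : ℝ) + 1)) *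
    volume (Metric.ball (0 : EuclideanSpace ℝ (Fin (m + 1))) 1) with hC₃
  have hC₃t : C₃ ≠ ⊤ := ENNReal.mul_ne_top ENNReal.ofReal_ne_top measure_ball_lt_top.ne
  -- Any `b` in `(1, 2)` would do: `θ₁ = b / 2 < 1` needs `b < 2`, and `θ₂ = b ^ (1 - q) < 1` needs
  -- `b > 1` and `q > 1`.
  set b : ℝ := √2 with hb
  have hb1 : 1 < b := by rw [hb, Real.lt_sqrt]; norm_num; norm_num
  have hb2 : b < 2 := by rw [hb, Real.sqrt_lt'] <;> norm_num
  set θ₁ : ℝ≥0∞ := ENNReal.ofReal b * (1 / 2) with hθ₁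
  set θ₂ : ℝ≥0∞ := ENNReal.ofReal (b ^ (1 - q)) with hθ₂
  have hθ₁1 : θ₁ < 1 := by
    have e : (1 / 2 : ℝ≥0∞) = ENNReal.ofReal (1 / 2) := by
      rw [ENNReal.ofReal_div_of_pos (by norm_num)]; simp
    rw [hθ₁, e, ← ENNReal.ofReal_mul (by linarith), ENNReal.ofReal_lt_one]
    linarith
  have hθ₂1 : θ₂ < 1 := by
    rw [hθ₂, ENNReal.ofReal_lt_one]
    exact Real.rpow_lt_one_of_one_lt_of_neg hb1 (by linarith)
  have hgeo : ∀ θ : ℝ≥0∞, θ < 1 → (1 - θ)⁻¹ ≠ ⊤ := by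
    intro θ hθ
    rw [ENNReal.inv_ne_top]
    exact (tsub_pos_of_lt hθ).ne'
  refine ⟨2 * ((W₀ + C₃) + ((1 - θ₁)⁻¹ + (1 - θ₂)⁻¹ * C₃)), ?_, ?_⟩
  · have := hgeo θ₁ hθ₁1
    have := hgeo θ₂ hθ₂1
    finiteness
  intro D s p g x M hD hs1 hsS hp hlog hW hx hM hgood
  set L : ℝ := (M : ℝ) ^ (1 / q) with hL
  have hM1 : (1 : ℝ) ≤ M := by exact_mod_cast hM
  have hL1 : 1 ≤ L := Real.one_le_rpow hM1 (by positivity)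
  set r : ℕ → ℝ := fun i => r₀ * (1 / 2) ^ i with hr
  have hr0 : ∀ i, 0 < r i := fun i => by simp only [hr]; positivity
  have hrle : ∀ i, r i ≤ r₀ := fun i =>
    mul_le_of_le_one_right (by linarith) (pow_le_one₀ (by norm_num) (by norm_num))
  set A : ℕ → Set (EuclideanSpace ℝ (Fin (m + 1))) := dyadicAnnulus D r₀ x with hA
  have hAm : ∀ i, MeasurableSet (A i) := measurableSet_dyadicAnnulus hD r₀ x
  set w : EuclideanSpace ℝ (Fin (m + 1)) → ℝ≥0∞ := fun y => ENNReal.ofReal (‖g y‖ ^ p y) with hw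
  set F : ℕ → ℝ≥0∞ := fun i => ENNReal.ofReal (r i ^ (-(s x * m))) * ∫⁻ y in A i, ‖g y‖ₑ with hF
  have hY : ∀ i t, 1 ≤ t → F i ≤ ENNReal.ofReal t * (∫⁻ y in A i, w y)
      + ENNReal.ofReal (t ^ (1 - q)) * C₃ := by
    intro i t ht
    exact ofReal_rpow_mul_lintegral_le hm hr₀ hc hSm hs1 hsS hp hlog hx (hr0 i) (hrle i) ht
      (hAm i) inter_subset_left (inter_subset_right.trans sdiff_subset)
  -- The parameter `L = M ^ (1 / q)` balances both terms of Young's inequality: `M * L ^ (1 - q) =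
  -- L`.
  have hfar : ∑ i ∈ Finset.range M, F i ≤ ENNReal.ofReal L * (W₀ + C₃) := by
    have h1 : ∑ i ∈ Finset.range M, ∫⁻ y in A i, w y ≤ W₀ := by
      refine (ENNReal.sum_le_tsum _).trans ?_
      rw [← lintegral_iUnion hAm (pairwise_disjoint_dyadicAnnulus D (by linarith) x)]
      exact (lintegral_mono_set (iUnion_subset fun i => inter_subset_left)).trans hW
    have h2 : (M : ℝ≥0∞) * ENNReal.ofReal (L ^ (1 - q)) = ENNReal.ofReal L := by
      have hM0 : (0 : ℝ) < M := by linarith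
      rw [← ENNReal.ofReal_natCast, ← ENNReal.ofReal_mul hM0.le]
      congr 1
      rw [hL, ← Real.rpow_mul hM0.le]
      nth_rewrite 1 [← Real.rpow_one (M : ℝ)]
      rw [← Real.rpow_add hM0]
      congr 1
      field_simp
      ring
    calc ∑ i ∈ Finset.range M, F i
        ≤ ∑ i ∈ Finset.range M, (ENNReal.ofReal L * (∫⁻ y in A i, w y)
          + ENNReal.ofReal (L ^ (1 - q)) * C₃) := Finset.sum_le_sum fun i _ => hY i L hL1
      _ = ENNReal.ofReal L * (∑ i ∈ Finset.range M, ∫⁻ y in A i, w y)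
          + (M : ℝ≥0∞) * ENNReal.ofReal (L ^ (1 - q)) * C₃ := by
          rw [Finset.sum_add_distrib, Finset.mul_sum, Finset.sum_const, Finset.card_range,
            nsmul_eq_mul, mul_assoc]
      _ ≤ ENNReal.ofReal L * W₀ + ENNReal.ofReal L * C₃ := by
          rw [h2]
          gcongr
      _ = ENNReal.ofReal L * (W₀ + C₃) := by ring
  -- At scale `M + k` the mass is at most `2⁻ᵏ`; the parameter `b ^ k` makes both terms geometric.
  have hnear : ∑' k, F (M + k) ≤ (1 - θ₁)⁻¹ + (1 - θ₂)⁻¹ * C₃ := by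
    rw [← ENNReal.tsum_geometric, ← ENNReal.tsum_geometric, ← ENNReal.tsum_mul_right,
      ← ENNReal.tsum_add]
    refine ENNReal.tsum_le_tsum fun k => ?_
    refine (hY (M + k) (b ^ k) (one_le_pow₀ hb1.le)).trans ?_
    refine add_le_add ?_ (mul_le_mul' (le_of_eq ?_) le_rfl)
    · rw [hθ₁, mul_pow, ENNReal.ofReal_pow (by linarith)]
      refine mul_le_mul' le_rfl ((lintegral_mono_set ?_).trans (hgood k))
      exact inter_subset_inter_right _ sdiff_subset
    · rw [hθ₂, ← ENNReal.ofReal_pow (by positivity), ← Real.rpow_natCast, ← Real.rpow_natCast,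
        ← Real.rpow_mul (by linarith), ← Real.rpow_mul (by linarith), mul_comm]
  have hβ : 1 ≤ s x * m := by
    have : (1 : ℝ) ≤ m := by exact_mod_cast hm
    nlinarith [hs1 x hx]
  have hsplit : ∑' i, F i = ∑ i ∈ Finset.range M, F i + ∑' k, F (M + k) := by
    rw [← Summable.sum_add_tsum_nat_add' (f := F) (k := M) ENNReal.summable]
    simp only [add_comm M]
  calc dyadicPotential D g r₀ (s x * m) x ≤ 2 * ∑' i, F i :=
        dyadicPotential_le_tsum_annulus (by linarith) hβ x
    _ = 2 * (∑ i ∈ Finset.range M, F i + ∑' k, F (M + k)) := by rw [hsplit]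
    _ ≤ 2 * (ENNReal.ofReal L * (W₀ + C₃) +
          ENNReal.ofReal L * ((1 - θ₁)⁻¹ + (1 - θ₂)⁻¹ * C₃)) := by
        gcongr
        refine hnear.trans (le_mul_of_one_le_left' ?_)
        simpa using hL1
    _ = _ := by ring

/-! ### Hausdorff content and concentration of the modular -/

section Content

variable {E : Type*} [MetricSpace E] {U : Set E} {β : E → ℝ}

theorem varHausdorffContent_mono {A A' : Set E} (h : A ⊆ A') :
    varHausdorffContent U β A ≤ varHausdorffContent U β A' := by
  refine le_iInf fun x => le_iInf fun r => le_iInf fun hx => le_iInf fun hr => le_iInf fun hA => ?_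
  exact iInf_le_of_le x (iInf_le_of_le r (iInf_le_of_le hx (iInf_le_of_le hr
    (iInf_le_of_le (h.trans hA) le_rfl))))

/-- Unused natural indices receive the empty ball of radius 0 at `x₀`, which costs `0 ^ β x₀ = 0`
because `β x₀ ≠ 0`. -/
theorem varHausdorffContent_le_tsum {ι : Type*} [Countable ι] {A : Set E} {x₀ : E} (hx₀ : x₀ ∈ U)
    (hβ : β x₀ ≠ 0) {x : ι → E} {r : ι → ℝ} (hx : ∀ i, x i ∈ U) (hr : ∀ i, 0 ≤ r i)
    (hA : A ⊆ ⋃ i, Metric.ball (x i) (r i)) :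
    varHausdorffContent U β A ≤ ∑' i, ENNReal.ofReal (r i ^ β (x i)) := by
  obtain ⟨e, he⟩ := exists_injective_nat ι
  have hxe : ∀ i, Function.extend e x (fun _ => x₀) (e i) = x i := fun i => he.extend_apply _ _ _
  have hre : ∀ i, Function.extend e r (fun _ => 0) (e i) = r i := fun i => he.extend_apply _ _ _
  refine iInf_le_of_le (Function.extend e x fun _ => x₀) (iInf_le_of_le
    (Function.extend e r fun _ => 0) (iInf_le_of_le ?_ (iInf_le_of_le ?_ (iInf_le_of_le ?_ ?_))))
  · intro k
    by_cases hk : ∃ i, e i = k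
    · obtain ⟨i, rfl⟩ := hk
      rw [hxe]; exact hx i
    · rw [Function.extend_apply' _ _ _ hk]; exact hx₀
  · intro k
    by_cases hk : ∃ i, e i = k
    · obtain ⟨i, rfl⟩ := hk
      rw [hre]; exact hr i
    · rw [Function.extend_apply' _ _ _ hk]
  · refine hA.trans (iUnion_subset fun i => ?_)
    refine subset_iUnion_of_subset (e i) ?_
    rw [hxe, hre]
  · rw [← he.tsum_eq]
    · simp only [hxe, hre]; exact le_rfl
    · intro k hk
      by_contra hcon
      refine hk ?_
      beta_reduce
      rw [Function.extend_apply' _ _ _ hcon, Function.extend_apply' _ _ _ hcon,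
        Real.zero_rpow hβ, ENNReal.ofReal_zero]

end Content

/-- The content of the set where the density of a finite measure is large at some small scale. -/
theorem varHausdorffContent_concentration_le {n : ℕ} {D : Set (EuclideanSpace ℝ (Fin n))}
    (hD : MeasurableSet D) {β : EuclideanSpace ℝ (Fin n) → ℝ} {N : ℝ} (hβ1 : ∀ x ∈ D, 1 ≤ β x)
    (hβN : ∀ x ∈ D, β x ≤ N) {r₀ : ℝ} (hr₀ : 1 ≤ r₀) (hne : D.Nonempty)
    (w : EuclideanSpace ℝ (Fin n) → ℝ≥0∞) (M : ℕ) :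
    varHausdorffContent D β {x ∈ D | ∃ k : ℕ,
        (1 / 2) ^ k < ∫⁻ y in D ∩ Metric.ball x (r₀ * (1 / 2) ^ (M + k)), w y}
      ≤ ENNReal.ofReal ((5 * r₀) ^ N) * (1 / 2) ^ M * ∫⁻ y in D, w y := by
  set T := {x ∈ D | ∃ k : ℕ,
    (1 / 2) ^ k < ∫⁻ y in D ∩ Metric.ball x (r₀ * (1 / 2) ^ (M + k)), w y} with hT
  have hex : ∀ x, ∃ k : ℕ, x ∈ T →
      (1 / 2) ^ k < ∫⁻ y in D ∩ Metric.ball x (r₀ * (1 / 2) ^ (M + k)), w y := by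
    intro x
    by_cases hx : x ∈ T
    · obtain ⟨k, hk⟩ := hx.2
      exact ⟨k, fun _ => hk⟩
    · exact ⟨0, fun h => absurd h hx⟩
  choose k hk using hex
  set r : EuclideanSpace ℝ (Fin n) → ℝ := fun x => r₀ * (1 / 2) ^ (M + k x) with hr
  have hr0 : ∀ x, 0 < r x := fun x => by simp only [hr]; positivity
  -- Vitali's lemma needs a factor above 3; going from 4 to 5 below turns closed balls into open
  -- ones.
  obtain ⟨v, hvT, hdisj, hcov⟩ := Vitali.exists_disjoint_subfamily_covering_enlargement_closedBall
    T (fun x => x) r r₀ (fun x _ => mul_le_of_le_one_right (by linarith)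
      (pow_le_one₀ (by norm_num) (by norm_num))) 4 (by norm_num)
  have hvc : v.Countable := by
    refine hdisj.countable_of_nonempty_interior fun x _ => ?_
    exact ⟨x, Metric.ball_subset_interior_closedBall (Metric.mem_ball_self (hr0 x))⟩
  have := hvc.to_subtype
  obtain ⟨z, hz⟩ := hne
  have hcover : T ⊆ ⋃ i : v, Metric.ball (i : EuclideanSpace ℝ (Fin n)) (5 * r i) := by
    intro x hx
    obtain ⟨b, hb, hsub⟩ := hcov x hx
    refine mem_iUnion.2 ⟨⟨b, hb⟩, ?_⟩
    have := Metric.mem_closedBall.1 (hsub (Metric.mem_closedBall_self (hr0 x).le))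
    rw [Metric.mem_ball]
    have := hr0 b
    dsimp only at *
    linarith
  refine (varHausdorffContent_le_tsum hz (by linarith [hβ1 z hz]) (fun i : v => (hvT i.2).1)
    (fun i => by have := hr0 i; positivity) hcover).trans ?_
  have hterm : ∀ i : v, ENNReal.ofReal ((5 * r i) ^ β i)
      ≤ ENNReal.ofReal ((5 * r₀) ^ N) * (1 / 2) ^ M *
        ∫⁻ y in D ∩ Metric.ball (i : EuclideanSpace ℝ (Fin n)) (r i), w y := by
    intro i
    have hiD := (hvT i.2).1
    have e : ∀ l : ℕ, (1 / 2 : ℝ≥0∞) ^ l = ENNReal.ofReal ((1 / 2) ^ l) := by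
      intro l
      rw [ENNReal.ofReal_pow (by norm_num), ENNReal.ofReal_div_of_pos (by norm_num)]; simp
    -- This is where `β ≥ 1` enters. The factor `2⁻ᵏ` is then paid by the mass of the ball, and
    -- `2⁻ᴹ` remains.
    have hreal : (5 * r i) ^ β i ≤ (5 * r₀) ^ N * ((1 / 2) ^ M * (1 / 2) ^ k i) := by
      have h1 : 5 * r i = 5 * r₀ * (1 / 2) ^ (M + k i) := by simp only [hr]; ring
      have h2 : (0 : ℝ) < (1 / 2) ^ (M + k i) := by positivity
      rw [h1, Real.mul_rpow (by positivity) h2.le, ← pow_add]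
      gcongr
      · linarith
      · exact hβN _ hiD
      · calc ((1 / 2 : ℝ) ^ (M + k i)) ^ β i ≤ ((1 / 2 : ℝ) ^ (M + k i)) ^ (1 : ℝ) :=
            Real.rpow_le_rpow_of_exponent_ge h2 (pow_le_one₀ (by norm_num) (by norm_num))
              (hβ1 _ hiD)
          _ = _ := Real.rpow_one _
    calc ENNReal.ofReal ((5 * r i) ^ β i)
        ≤ ENNReal.ofReal ((5 * r₀) ^ N * ((1 / 2) ^ M * (1 / 2) ^ k i)) :=
          ENNReal.ofReal_le_ofReal hreal
      _ = ENNReal.ofReal ((5 * r₀) ^ N) * (1 / 2) ^ M * (1 / 2) ^ k i := by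
          rw [ENNReal.ofReal_mul (by positivity), ENNReal.ofReal_mul (by positivity), ← e, ← e,
            mul_assoc]
      _ ≤ _ := mul_le_mul' le_rfl (hk i (hvT i.2)).le
  refine (ENNReal.tsum_le_tsum hterm).trans ?_
  rw [ENNReal.tsum_mul_left]
  refine mul_le_mul' le_rfl ?_
  rw [← lintegral_iUnion (fun i : v => hD.inter measurableSet_ball)]
  · exact lintegral_mono_set (iUnion_subset fun i => inter_subset_left)
  · intro i j hij
    refine (hdisj i.2 j.2 fun h => hij (Subtype.ext h)).mono ?_ ?_ <;>
    exact inter_subset_right.trans Metric.ball_subset_closedBall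

/-! ### From essential bounds and the norm to pointwise bounds and the modular -/

/-- If `s x` exceeded the essential supremum by `δ`, then so would `s`, by less, on the part of `D`
within `exp (-(c / δ))` of `x`, an open set of positive measure. The bound is needed at every point,
since contents and John curves see single points. -/
theorem IsLogHolderOn.le_essSupOn {E : Type*} [MetricSpace E] [MeasureSpace E]
    [OpensMeasurableSpace E] [(volume : Measure E).IsOpenPosMeasure] {s : E → ℝ} {D : Set E}
    (hD : IsOpen D) (hs : IsLogHolderOn s D)
    (hb : ∃ C : ℝ, ∀ᵐ x ∂(volume.restrict D), s x ≤ C) {x : E} (hx : x ∈ D) :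
    s x ≤ essSupOn s D := by
  obtain ⟨C, hC⟩ := hb
  have hae : ∀ᵐ y ∂(volume.restrict D), s y ≤ essSupOn s D :=
    ae_le_essSup ⟨C, eventually_map.2 hC⟩
  obtain ⟨c, hc, hlog⟩ := hs
  by_contra! hlt
  set δ := s x - essSupOn s D with hδ
  have hδ0 : 0 < δ := by linarith
  set η := Real.exp (-(c / δ)) with hη
  have hopen : IsOpen (Metric.ball x η ∩ D) := Metric.isOpen_ball.inter hD
  have hpos : 0 < volume (Metric.ball x η ∩ D) :=
    hopen.measure_pos _ ⟨x, Metric.mem_ball_self (Real.exp_pos _), hx⟩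
  have hex : ∃ y ∈ Metric.ball x η ∩ D, s y ≤ essSupOn s D := by
    by_contra! hcon
    rw [ae_restrict_iff' hD.measurableSet] at hae
    have : volume (Metric.ball x η ∩ D) = 0 := by
      refine measure_mono_null (fun y hy => ?_) (ae_iff.1 hae)
      simp only [mem_ofPred_eq, Classical.not_imp, not_le]
      exact ⟨hy.2, hcon y hy⟩
    exact hpos.ne' this
  obtain ⟨y, ⟨hyx, hyD⟩, hy⟩ := hex
  have hne : x ≠ y := by rintro rfl; linarith
  have hd : 0 < dist x y := dist_pos.2 hne
  have h1 := hlog x hx y hyD hne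
  have h2 : c / δ < Real.log (Real.exp 1 + 1 / dist x y) := by
    rw [Real.lt_log_iff_exp_lt (by positivity)]
    have h3 : dist x y < Real.exp (-(c / δ)) := Metric.mem_ball'.1 hyx
    have h4 : Real.exp (c / δ) < 1 / dist x y := by
      rw [lt_div_iff₀ hd]
      calc Real.exp (c / δ) * dist x y < Real.exp (c / δ) * Real.exp (-(c / δ)) := by gcongr
        _ = 1 := by rw [← Real.exp_add]; simp
    linarith [Real.exp_pos 1]
  have h5 : c / Real.log (Real.exp 1 + 1 / dist x y) < δ := by
    rw [div_lt_iff₀ (lt_trans (by positivity) h2)]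
    rwa [div_lt_iff₀' hδ0] at h2
  linarith [le_abs_self (s x - s y)]

/-- Taking an admissible `l < 2` avoids the question whether the infimum is attained, at the
harmless price `2 ^ P`. -/
theorem lintegral_rpow_le_of_luxemburgNorm_le_one {E : Type*} [MeasureSpace E]
    {D : Set E} (hD : MeasurableSet D) {p f : E → ℝ} {P : ℝ} (hp0 : ∀ x ∈ D, 0 ≤ p x)
    (hpP : ∀ x ∈ D, p x ≤ P) (hf : ∀ x, 0 ≤ f x) (h : luxemburgNorm D p f ≤ 1) :
    ∫⁻ x in D, ENNReal.ofReal (f x ^ p x) ≤ ENNReal.ofReal (2 ^ P) := by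
  have hlt : luxemburgNorm D p f < 2 := h.trans_lt (by norm_num)
  simp only [luxemburgNorm, iInf_lt_iff] at hlt
  obtain ⟨l, hl0, hmod, hl2⟩ := hlt
  have hl2' : l < 2 := by
    have : ENNReal.ofReal l < ENNReal.ofReal 2 := by simpa using hl2
    exact (ENNReal.ofReal_lt_ofReal_iff (by norm_num)).1 this
  calc ∫⁻ x in D, ENNReal.ofReal (f x ^ p x)
      ≤ ∫⁻ x in D, ENNReal.ofReal (2 ^ P) * ENNReal.ofReal (|f x / l| ^ p x) := by
        refine setLIntegral_mono' hD fun x hx => ?_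
        rw [← ENNReal.ofReal_mul (by positivity)]
        refine ENNReal.ofReal_le_ofReal ?_
        have hfl : 0 ≤ f x / l := div_nonneg (hf x) hl0.le
        rw [abs_of_nonneg hfl]
        calc f x ^ p x = (l * (f x / l)) ^ p x := by rw [mul_div_cancel₀ _ hl0.ne']
          _ = l ^ p x * (f x / l) ^ p x := Real.mul_rpow hl0.le hfl
          _ ≤ 2 ^ p x * (f x / l) ^ p x := by
              gcongr
              exact hp0 x hx
          _ ≤ 2 ^ P * (f x / l) ^ p x := by
              gcongr
              · norm_num
              · exact hpP x hx
    _ = ENNReal.ofReal (2 ^ P) * varModular D p (fun x => f x / l) :=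
        lintegral_const_mul' _ _ ENNReal.ofReal_ne_top
    _ ≤ ENNReal.ofReal (2 ^ P) := mul_le_of_le_one_right' hmod

/-! ### Exponential integrability and the conclusion -/

/-- Exponential decay of the distribution function at the scale `M ^ (1 / q)` gives exponential
integrability. -/
theorem exists_choquetIntegral_exp_le {E : Type*} {D : Set E} {C₁ q : ℝ} {C₂ : ℝ≥0∞}
    (hC₁ : 0 < C₁) (hq : 0 < q) (hC₂ : C₂ ≠ ⊤) :
    ∃ a b : ℝ, 0 < a ∧ 0 < b ∧ ∀ (H : Set E → ℝ≥0∞) (v : E → ℝ),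
      (∀ A B, A ⊆ B → H A ≤ H B) → H D ≤ C₂ →
      (∀ M : ℕ, 1 ≤ M → H {x ∈ D | C₁ * (M : ℝ) ^ (1 / q) < |v x|} ≤ C₂ * (1 / 2) ^ M) →
      choquetIntegral H D (fun x => Real.exp (a * |v x| ^ q)) ≤ ENNReal.ofReal b := by
  -- With this `a`, `exp (a * |v| ^ q) > t` forces `|v| ^ q > C₁ ^ q * y` with `y = 2 * log t / log
  -- 2`. Taking `M = ⌊y⌋₊` gives content at most `2 * C₂ * t⁻²`, which is integrable at infinity.
  set a := Real.log 2 / (2 * C₁ ^ q) with ha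
  have hlog2 : 0 < Real.log 2 := Real.log_pos (by norm_num)
  have hC₁q : 0 < C₁ ^ q := by positivity
  have ha0 : 0 < a := by positivity
  set I : ℝ≥0∞ := ∫⁻ t in Ioi (2 : ℝ), ENNReal.ofReal (t ^ (-2 : ℝ)) with hI
  have hIt : I ≠ ⊤ := by
    have := (integrableOn_Ioi_rpow_of_lt (a := -2) (by norm_num) (c := 2) (by norm_num))
    exact this.lintegral_lt_top.ne
  set Z : ℝ≥0∞ := C₂ * 2 + C₂ * 2 * I with hZ
  have hZt : Z ≠ ⊤ := by rw [hZ]; finiteness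
  refine ⟨a, Z.toReal + 1, ha0, by positivity, fun H v hmono hHD hlev => ?_⟩
  have hsmall : ∀ t : ℝ, H {x ∈ D | t < |Real.exp (a * |v x| ^ q)|} ≤ C₂ := fun t =>
    (hmono _ _ (sep_subset _ _)).trans hHD
  have hlarge : ∀ t ∈ Ioi (2 : ℝ), H {x ∈ D | t < |Real.exp (a * |v x| ^ q)|}
      ≤ C₂ * 2 * ENNReal.ofReal (t ^ (-2 : ℝ)) := by
    intro t ht
    have ht2 : (2 : ℝ) < t := ht
    have ht0 : 0 < t := by linarith
    set y := 2 * Real.log t / Real.log 2 with hy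
    have hlt : Real.log 2 ≤ Real.log t := Real.log_le_log (by norm_num) ht2.le
    have hy1 : 1 ≤ y := by
      rw [hy, le_div_iff₀ hlog2]; linarith
    have hM1 : 1 ≤ ⌊y⌋₊ := Nat.one_le_floor_iff y |>.2 hy1
    have hMy : (⌊y⌋₊ : ℝ) ≤ y := Nat.floor_le (by linarith)
    refine (hmono _ {x ∈ D | C₁ * (⌊y⌋₊ : ℝ) ^ (1 / q) < |v x|} ?_).trans
      ((hlev _ hM1).trans ?_)
    · rintro x ⟨hxD, hx⟩
      refine ⟨hxD, ?_⟩
      rw [abs_of_pos (Real.exp_pos _), ← Real.log_lt_iff_lt_exp ht0] at hx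
      have h1 : C₁ ^ q * y < |v x| ^ q := by
        have e : C₁ ^ q * y = Real.log t / a := by rw [hy, ha]; field_simp
        rw [e, div_lt_iff₀' ha0]
        exact hx
      have h2 : (C₁ * (⌊y⌋₊ : ℝ) ^ (1 / q)) ^ q ≤ C₁ ^ q * y := by
        rw [Real.mul_rpow hC₁.le (by positivity), ← Real.rpow_mul (by positivity),
          one_div_mul_cancel hq.ne', Real.rpow_one]
        gcongr
      exact (Real.rpow_lt_rpow_iff (by positivity) (abs_nonneg _) hq).1 (h2.trans_lt h1)
    · rw [mul_assoc]
      refine mul_le_mul' le_rfl ?_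
      have e : (1 / 2 : ℝ≥0∞) ^ ⌊y⌋₊ = ENNReal.ofReal ((1 / 2) ^ ⌊y⌋₊) := by
        rw [ENNReal.ofReal_pow (by norm_num), ENNReal.ofReal_div_of_pos (by norm_num)]; simp
      have e2 : (2 : ℝ≥0∞) = ENNReal.ofReal 2 := by simp
      rw [e, e2, ← ENNReal.ofReal_mul (by norm_num)]
      refine ENNReal.ofReal_le_ofReal ?_
      have h3 : y - 1 ≤ ⌊y⌋₊ := (Nat.sub_one_lt_floor y).le
      calc ((1 / 2 : ℝ)) ^ ⌊y⌋₊ = (1 / 2 : ℝ) ^ (⌊y⌋₊ : ℝ) := (Real.rpow_natCast _ _).symm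
        _ ≤ (1 / 2 : ℝ) ^ (y - 1) :=
            Real.rpow_le_rpow_of_exponent_ge (by norm_num) (by norm_num) h3
        _ = 2 * t ^ (-2 : ℝ) := by
            rw [one_div, Real.inv_rpow (by norm_num), ← Real.rpow_neg (by norm_num), neg_sub,
              Real.rpow_sub (by norm_num), Real.rpow_one, div_eq_mul_inv,
              ← Real.rpow_neg (by norm_num), Real.rpow_def_of_pos (by norm_num),
              Real.rpow_def_of_pos ht0]
            congr 2
            rw [hy]; field_simp
  calc choquetIntegral H D (fun x => Real.exp (a * |v x| ^ q))
      ≤ (∫⁻ t in Ioc (0 : ℝ) 2, H {x ∈ D | t < |Real.exp (a * |v x| ^ q)|}) +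
        ∫⁻ t in Ioi (2 : ℝ), H {x ∈ D | t < |Real.exp (a * |v x| ^ q)|} := by
        rw [choquetIntegral, ← Ioc_union_Ioi_eq_Ioi (a := (0 : ℝ)) (b := 2) (by norm_num)]
        exact lintegral_union_le _ _ _
    _ ≤ (∫⁻ _ in Ioc (0 : ℝ) 2, C₂) +
        ∫⁻ t in Ioi (2 : ℝ), C₂ * 2 * ENNReal.ofReal (t ^ (-2 : ℝ)) := by
        refine add_le_add (lintegral_mono fun t => hsmall t) ?_
        exact setLIntegral_mono' measurableSet_Ioi hlarge
    _ = Z := by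
        rw [lintegral_const, Measure.restrict_apply_univ, Real.volume_Ioc,
          lintegral_const_mul' _ _ (by finiteness), hZ, sub_zero, ENNReal.ofReal_ofNat]
    _ = ENNReal.ofReal Z.toReal := (ENNReal.ofReal_toReal hZt).symm
    _ ≤ ENNReal.ofReal (Z.toReal + 1) := ENNReal.ofReal_le_ofReal (by linarith)

theorem mainTheorem2 (n : ℕ) (hn : 2 ≤ n) (D : Set (EuclideanSpace ℝ (Fin n)))
    (s : EuclideanSpace ℝ (Fin n) → ℝ) (x₀ : EuclideanSpace ℝ (Fin n))
    (hD : IsVarJohnDomain D s x₀) (hs : IsLogHolderExponent s D)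
    (hs_inf : 1 ≤ essInfOn s D) (hs_sup : essSupOn s D < (n : ℝ) / ((n : ℝ) - 1))
    (α : EuclideanSpace ℝ (Fin n) → ℝ) (hα : ∀ x ∈ D, α x = (n : ℝ) - s x * ((n : ℝ) - 1)) :
    ∃ a b : ℝ, 0 < a ∧ 0 < b ∧
      ∀ (u : EuclideanSpace ℝ (Fin n) → ℝ)
        (gradu : EuclideanSpace ℝ (Fin n) → EuclideanSpace ℝ (Fin n)),
        MemVarSobolev D (fun x => (n : ℝ) / α x) u gradu →
        luxemburgNorm D (fun x => (n : ℝ) / α x) (fun x => ‖gradu x‖) ≤ 1 →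
        choquetIntegral (varHausdorffContent D (fun x => s x * ((n : ℝ) - 1))) D
          (fun x => Real.exp (a *
            |preciseRep u x - ⨍ y in Metric.ball x₀ (Metric.infDist x₀ (frontier D)), u y|
              ^ ((n : ℝ) / (essSupOn s D * ((n : ℝ) - 1)))))
          ≤ ENNReal.ofReal b := by
  obtain ⟨m, rfl⟩ : ∃ m, n = m + 1 := ⟨n - 1, by omega⟩
  have hm : 1 ≤ m := by omega
  have hm1 : (1 : ℝ) ≤ m := by exact_mod_cast hm
  have hcast : ((m + 1 : ℕ) : ℝ) = m + 1 := by push_cast; rfl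
  simp only [hcast, add_sub_cancel_right] at *
  set S := essSupOn s D
  obtain ⟨A, B, hJohn⟩ := hD
  have hDo := hJohn.isOpen
  have hDm := hDo.measurableSet
  have hx₀ := hJohn.center_mem
  have hs1 := hs.one_le
  have hsS : ∀ x ∈ D, s x ≤ S := fun x hx => hs.logHolder.le_essSupOn hDo hs.essBounded hx
  have hS1 : 1 ≤ S := (hs1 x₀ hx₀).trans (hsS x₀ hx₀)
  have hSm : S * m < m + 1 := by rwa [lt_div_iff₀ (by linarith)] at hs_sup
  -- Because `n / (n - 1) ≤ 2` for `n ≥ 2`.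
  have hS2 : S ≤ 2 := by nlinarith
  obtain ⟨c, hc, hlog⟩ := hs.logHolder
  obtain ⟨R, K, hR, hK, hball, hcurve⟩ :=
    IsVarJohnDomain.exists_curves ⟨A, B, hJohn⟩ fun x hx => (hsS x hx).trans hS2
  set d₀ := Metric.infDist x₀ (frontier D) with hd₀
  set P : ℝ := (m + 1) / ((m + 1) - S * m) with hP
  set W₀ : ℝ≥0∞ := ENNReal.ofReal (2 ^ P)
  have hr₀ : 1 ≤ 2 * R ^ 2 := by nlinarith
  obtain ⟨Cp, hCp, hpoint⟩ := exists_edist_preciseRep_le m (d₀ := d₀) hR hK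
  obtain ⟨Cg, hCg, hgood⟩ := exists_dyadicPotential_le (W₀ := W₀) hm hr₀ hc.le hS1 hSm
    ENNReal.ofReal_ne_top
  set β : EuclideanSpace ℝ (Fin (m + 1)) → ℝ := fun x => s x * m with hβ
  have hβ1 : ∀ x ∈ D, 1 ≤ β x := fun x hx => by
    have := hs1 x hx
    simp only [hβ]; nlinarith
  have hβS : ∀ x ∈ D, β x ≤ S * m := fun x hx => by
    have := hsS x hx
    simp only [hβ]; gcongr
  have hDcontent : varHausdorffContent D β D ≤ ENNReal.ofReal (R ^ β x₀) := by
    refine (varHausdorffContent_le_tsum (ι := Unit) hx₀ (by linarith [hβ1 x₀ hx₀])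
      (x := fun _ => x₀) (r := fun _ => R) (fun _ => hx₀) (fun _ => by linarith) ?_).trans ?_
    · exact (hball x₀ hx₀).trans (subset_iUnion_of_subset () le_rfl)
    · simp
  have hq : 0 < (m + 1) / (S * m) := by positivity
  -- `C₁` is the product of the constants of the pointwise and potential bounds, plus 1 for
  -- positivity. `C₂` adds the content of `D`, covered by one ball of radius `R`, to the Vitali
  -- constant times the bound for the modular. None depends on `u`.
  obtain ⟨a, b, ha, hb, hfinal⟩ := exists_choquetIntegral_exp_le (D := D)
    (C₁ := (Cp * Cg).toReal + 1) (q := (m + 1) / (S * m))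
    (C₂ := ENNReal.ofReal (R ^ β x₀) + ENNReal.ofReal ((5 * (2 * R ^ 2)) ^ (S * m)) * W₀)
    (by positivity) hq (by finiteness)
  refine ⟨a, b, ha, hb, fun u g hu hnorm => hfinal _ _ (fun _ _ => varHausdorffContent_mono)
    (hDcontent.trans le_self_add) fun M hM => ?_⟩
  set p : EuclideanSpace ℝ (Fin (m + 1)) → ℝ := fun x => (m + 1) / α x with hp
  have hpD : ∀ x ∈ D, p x = (m + 1) / ((m + 1) - s x * m) := fun x hx => by
    simp only [hp]; rw [hα x hx]
  have hαpos : ∀ x ∈ D, 0 < (m + 1) - s x * m := fun x hx => by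
    have := hβS x hx
    simp only [hβ] at this
    linarith
  have hW : ∫⁻ y in D, ENNReal.ofReal (‖g y‖ ^ p y) ≤ W₀ := by
    refine lintegral_rpow_le_of_luxemburgNorm_le_one hDm (fun x hx => ?_) (fun x hx => ?_)
      (fun x => norm_nonneg (g x)) hnorm
    · rw [hpD x hx]
      have := hαpos x hx
      positivity
    · rw [hpD x hx, hP]
      have := hβS x hx
      simp only [hβ] at this
      gcongr
  set T := {x ∈ D | ∃ k : ℕ, (1 / 2) ^ k <
    ∫⁻ y in D ∩ Metric.ball x (2 * R ^ 2 * (1 / 2) ^ (M + k)), ENNReal.ofReal (‖g y‖ ^ p y)} with hT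
  refine (varHausdorffContent_mono (A' := T) ?_).trans ?_
  · rintro x ⟨hxD, hx⟩
    by_contra hxT
    have hx' : ∀ k : ℕ, ∫⁻ y in D ∩ Metric.ball x (2 * R ^ 2 * (1 / 2) ^ (M + k)),
        ENNReal.ofReal (‖g y‖ ^ p y) ≤ (1 / 2) ^ k := by
      intro k
      by_contra! hk
      exact hxT ⟨hxD, k, hk⟩
    obtain ⟨γ, hγ, hγ0, hγR, hγJ⟩ := hcurve x hxD
    have h1 := hpoint D u g x x₀ γ (s x) hDo hu.hasWeakGradient hxD (hball x hxD) (hs1 x hxD)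
      ((hsS x hxD).trans hS2) hγ hγ0 hγR hγJ hd₀
    have h2 := hgood D s p g x M hDm hs1 hsS hpD hlog hW hxD hM hx'
    have h3 := h1.trans (mul_le_mul' le_rfl h2)
    have hCC : Cp * Cg ≠ ⊤ := ENNReal.mul_ne_top hCp hCg
    rw [← mul_assoc, edist_dist, Real.dist_eq, ← ENNReal.ofReal_toReal hCC,
      ← ENNReal.ofReal_mul ENNReal.toReal_nonneg,
      ENNReal.ofReal_le_ofReal_iff (by positivity)] at h3
    have h4 : 0 ≤ (M : ℝ) ^ (1 / ((m + 1) / (S * m)) : ℝ) := by positivity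
    nlinarith
  · refine (varHausdorffContent_concentration_le hDm hβ1 hβS hr₀ ⟨x₀, hx₀⟩ _ M).trans ?_
    calc ENNReal.ofReal ((5 * (2 * R ^ 2)) ^ (S * m)) * (1 / 2) ^ M *
          ∫⁻ y in D, ENNReal.ofReal (‖g y‖ ^ p y)
        ≤ ENNReal.ofReal ((5 * (2 * R ^ 2)) ^ (S * m)) * (1 / 2) ^ M * W₀ :=
          mul_le_mul' le_rfl hW
      _ = ENNReal.ofReal ((5 * (2 * R ^ 2)) ^ (S * m)) * W₀ * (1 / 2) ^ M := by ring
      _ ≤ _ := mul_le_mul' le_add_self le_rfl
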